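/- Let $I=[-1,1]$. Consider random design regression: one observes $n$ independent copies of $(X,Y)$, $Y=f(X)+\xi$, where $\xi\sim\mathcal N(0,1)$ is independent of $X$, $X$ has law $\mu$ on $I^d$, and $E_f$ is the expectation under the regression function $f:I^d\to\mathbb R$. Suppose $\mu$ has a density $g$ with respect to Lebesgue measure on $I^d$ with $c_g^{\,d}\le g\le C_g^{\,d}$, for constants $0<c_g,C_g<\infty$. For $\beta>0$ let $\lfloor\beta\rfloor$ be the largest integer strictly smaller than $\beta$, and for $h:I^r\to\mathbb R$ let $$\|h\|_{\beta,\infty}=\max\Big(\max_{|\alpha|\le\lfloor\beta\rfloor}\|\partial^\alpha h\|_\infty,\ \max_{|\alpha|=\lfloor\beta\rfloor}\ \sup_{x\ne y\in I^r}\frac{|\partial^\alpha h(x)-\partial^\alpha h(y)|}{|x-y|_\infty^{\beta-\lfloor\beta\rfloor}}\Big).$$ For integers $1\le d^*\le d$ and $D>0$, let $\mathcal F_{VS}(D,\beta,d,d^*)$ be the set of functions $f:I^d\to\mathbb R$ of the form $f(x_1,\dots,x_d)=h(x_{i_1},\dots,x_{i_{d^*}})$ for distinct indices $i_1,\dots,i_{d^*}$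 and some $h:I^{d^*}\to\mathbb R$ with continuous partial derivatives up to order $\lfloor\beta\rfloor$, $\|h\|_\infty\le1$ and $\|h\|_{\beta,\infty}\le D$. There exist an integer $N_0=N_0(\beta,D)$ and constants $C_2,c_2>0$ depending only on $\beta,c_g,C_g$ such that, for every $\varepsilon\in(0,1/2)$, every $n\ge N_0$ and all integers $1\le d^*\le d$ with $d^*\le(\log n)^{1/2-\varepsilon}$, $$\inf_T\ \sup_{f\in\mathcal F_{VS}(D,\beta,d,d^*)}E_f\|T-f\|_{L^2(\mu)}^2\ \ge\ C_2\,c_2^{\,d^*}D^{\frac{2d^*}{2\beta+d^*}}\,n^{-\frac{2\beta}{2\beta+d^*}},$$ the infimum being over all measurable estimators $T$ based on the $n$ observations. In particular, for fixed $D$ this minimax risk is at least $\kappa\, c_2^{\,d^*}n^{-2\beta/(2\beta+d^*)}$ with $\kappa=\kappa(\beta,D,c_g,C_g)>0$, and the factor $c_2^{\,d^*}$ is of smaller order than any power of $n$: for all $\varepsilon\in(0,1/2)$ and $\delta>0$ there is $N$ such that $n^{-\delta}\le c_2^{\,d^*}\le n^{\delta}$ whenever $n\ge N$ and $1\le d^*\le(\log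 n)^{1/2-\varepsilon}$. -/

import Mathlib

open MeasureTheory ProbabilityTheory
open scoped ENNReal

/-- The cube `I^r = [-1,1]^r`. The norm of `Fin r → ℝ` is the sup norm `|·|_∞`. -/
def cube (r : ℕ) : Set (Fin r → ℝ) := Set.Icc (-1) 1

/-- The largest integer strictly smaller than `β` (for `β > 0`). -/
noncomputable def strictFloor (β : ℝ) : ℕ := ⌈β⌉₊ - 1

/-- The iterated partial derivative `∂_{i 0} ⋯ ∂_{i (k-1)} g (x)` of `g` on the cube (one-sided on
the boundary). As `i` runs through all `k`-tuples of coordinates, this runs through all the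
`∂^α g (x)` with `|α| = k`. -/
noncomputable def cubePartial {r k : ℕ} (g : (Fin r → ℝ) → ℝ) (i : Fin k → Fin r)
    (x : Fin r → ℝ) : ℝ :=
  iteratedFDerivWithin ℝ k g (cube r) x (fun j => Pi.single (i j) (1 : ℝ))

/-- The Hölder norm `‖g‖_{β,∞}` of `g` on `[-1,1]^r`, with value `∞` allowed: the maximum of the
sup norms of all partial derivatives of order at most `⌊β⌋`, and of the `(β - ⌊β⌋)`-Hölder
quotients (for the sup norm) of the partial derivatives of order `⌊β⌋`. -/
noncomputable def holderNorm {r : ℕ} (β : ℝ) (g : (Fin r → ℝ) → ℝ) : ℝ≥0∞ :=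
  max
    (⨆ (k : ℕ) (_ : k ≤ strictFloor β) (i : Fin k → Fin r) (x ∈ cube r),
      ENNReal.ofReal |cubePartial g i x|)
    (⨆ (i : Fin (strictFloor β) → Fin r) (x ∈ cube r) (y ∈ cube r) (_ : x ≠ y),
      ENNReal.ofReal
        (|cubePartial g i x - cubePartial g i y| / ‖x - y‖ ^ (β - strictFloor β)))

/-- The class `F_VS(K, β, d, d*)` of functions `f : [-1,1]^d → ℝ` of the form
`f x = g (x_{i_1}, …, x_{i_{d*}})`, for distinct coordinates `i_1, …, i_{d*}` and a function
`g ∈ C^β([-1,1]^{d*})` with `‖g‖_∞ ≤ 1` and `‖g‖_{β,∞} ≤ K`. -/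
def classVS (K β : ℝ) (d ds : ℕ) : Set (cube d → ℝ) :=
  {f | ∃ (i : Fin ds → Fin d) (g : (Fin ds → ℝ) → ℝ), Function.Injective i ∧
      (∀ x : cube d, f x = g (fun j => x.1 (i j))) ∧
      ContDiffOn ℝ (strictFloor β) g (cube ds) ∧
      (∀ x ∈ cube ds, |g x| ≤ 1) ∧
      holderNorm β g ≤ ENNReal.ofReal K}

/-- The law `P_f` of one observation `(X, Y)`, `Y = f(X) + ε`, with `X ∼ μ` and an independent
`ε ∼ N(0,1)`: it has density `(x, y) ↦ (2π)^{-1/2} exp (-(y - f x)^2 / 2)` with respect to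
the product of `μ` and the Lebesgue measure. -/
noncomputable def obsLaw {d : ℕ} (μ : Measure (cube d)) (f : cube d → ℝ) :
    Measure (cube d × ℝ) :=
  (μ.prod volume).withDensity (fun p => gaussianPDF (f p.1) 1 p.2)

/-- The risk `E_f ‖T - f‖²_{L²(μ)}` of the estimator `T` based on `n` independent observations. -/
noncomputable def l2Risk {d : ℕ} (n : ℕ) (μ : Measure (cube d)) (f : cube d → ℝ)
    (T : (Fin n → cube d × ℝ) → cube d → ℝ) : ℝ≥0∞ :=
  ∫⁻ z, ∫⁻ x, ENNReal.ofReal ((T z x - f x) ^ 2) ∂μ ∂(Measure.pi fun _ : Fin n => obsLaw μ f)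

/-- The minimax risk over the class `F`; the infimum is over all (jointly measurable) estimators. -/
noncomputable def minimaxL2Risk {d : ℕ} (n : ℕ) (μ : Measure (cube d)) (F : Set (cube d → ℝ)) :
    ℝ≥0∞ :=
  ⨅ (T : (Fin n → cube d × ℝ) → cube d → ℝ) (_ : Measurable (Function.uncurry T)),
    ⨆ f ∈ F, l2Risk n μ f T

/-- `μ` is a probability measure on `[-1,1]^d` that has a density `p` with respect to the Lebesgue
measure such that `c^d ≤ p ≤ C^d`. -/
def IsDesign {d : ℕ} (c C : ℝ) (μ : Measure (cube d)) : Prop :=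
  IsProbabilityMeasure μ ∧ ∃ p : cube d → ℝ, Measurable p ∧
    (∀ x, c ^ d ≤ p x ∧ p x ≤ C ^ d) ∧
    μ = (Measure.comap ((↑) : cube d → (Fin d → ℝ)) volume).withDensity
      (fun x => ENNReal.ofReal (p x))

/-! The bound is Assouad's method over the functions `∑ k, ω k * a k * ψ k`, `ω ∈ {0,1}^J`, where
`k` runs through the `m ^ r` grid cells in `r = d*` well chosen coordinates and `ψ k` is a tensor
bump equal to `1` on cell `P k`. Flipping one bit changes the function by `a k * ψ k`; this cannot
be detected from `n` observations when `n * a k ^ 2 * s k ≤ 1`, with `s k = ∫ ψ k ^ 2 ∂μ`, and cell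
`k` then contributes order `a k ^ 2 * μ (P k)` to the risk (`assouad_minimaxL2Risk`).

The difficulty is that `p ≤ Cg ^ d` controls the marginal of `μ` on `r` coordinates only up to a
factor exponential in `d`, whereas the loss must be exponential in `r`. Two devices deal with this.
The amplitudes `a k = γ / √(1 + n γ² s k)` adapt to the mass under each bump, so the constraint
always holds and the risk is at least `γ² / 16 * E[1 / w]`, with `w = 1 + m ^ r * s k` on cell `k`.
Then `exists_block` compares `q = d / r` disjoint blocks of coordinates: the density bound gives
`E[∏ w_b] ≤ A ^ d * W ^ q`, so by Jensen some block has `E[log w] ≤ 2 r log A + log W`, and Jensen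
again gives `E[1 / w] ≥ (A ^ (2 r) * W)⁻¹`.

Sums of tensor bumps over the grid factorise, so Hölder norms cost only `B ^ r`
(`holderNorm_bumpSum_le`). The rate comes from `γ = D m ^ (-β) / (2B) ^ r` and `m ≈ (n D²) ^ (1 /
(2β + r))`. The growth condition on `r` gives `D ^ r ≤ n ^ β`, hence `D ≤ m ^ β`, which keeps the
functions bounded by `1`; it also makes `c₂ ^ r` subpolynomial. -/

/-! ### Product densities. -/

theorem lintegral_pi_prod_eq_prod {E : Type*} [MeasurableSpace E] (ν : Measure E) [SigmaFinite ν]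
    {n : ℕ} (f : Fin n → E → ℝ≥0∞) (hf : ∀ i, Measurable (f i)) :
    ∫⁻ z, ∏ i, f i (z i) ∂(Measure.pi fun _ : Fin n => ν) = ∏ i, ∫⁻ x, f i x ∂ν := by
  induction n with
  | zero => simp
  | succ n ih =>
    rw [Fin.prod_univ_succ, ← ih (fun i => f i.succ) fun i => hf _,
      ← lintegral_prod_mul (hf 0).aemeasurable (g := fun z : Fin n → E => ∏ i, f i.succ (z i))
        (Finset.measurable_fun_prod _ fun i _ => (hf _).comp (measurable_pi_apply i)).aemeasurable,
      ← ((measurePreserving_piFinSuccAbove (fun _ : Fin (n + 1) => ν) 0).symm).lintegral_comp_emb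
        (MeasurableEquiv.measurableEmbedding _)]
    refine lintegral_congr fun z => ?_
    simp [MeasurableEquiv.piFinSuccAbove_symm_apply, Fin.insertNthEquiv, Fin.prod_univ_succ]

theorem pi_withDensity_eq {E : Type*} [MeasurableSpace E] (ν : Measure E) [SigmaFinite ν]
    (n : ℕ) (f : E → ℝ≥0∞) (hf : Measurable f) [SigmaFinite (ν.withDensity f)] :
    (Measure.pi fun _ : Fin n => ν.withDensity f) =
      (Measure.pi fun _ : Fin n => ν).withDensity fun z => ∏ i, f (z i) := by
  refine Measure.pi_eq fun s hs => ?_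
  rw [withDensity_apply _ (MeasurableSet.univ_pi hs),
    ← lintegral_indicator (MeasurableSet.univ_pi hs)]
  simp_rw [withDensity_apply _ (hs _), ← lintegral_indicator (hs _)]
  rw [← lintegral_pi_prod_eq_prod ν _ fun i => hf.indicator (hs i)]
  refine lintegral_congr fun z => ?_
  by_cases hz : z ∈ Set.univ.pi s
  · rw [Set.indicator_of_mem hz]
    exact Finset.prod_congr rfl fun i _ =>
      (Set.indicator_of_mem (hz i (Set.mem_univ i)) f).symm
  · rw [Set.indicator_of_notMem hz]
    simp only [Set.mem_univ_pi, not_forall] at hz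
    obtain ⟨i, hi⟩ := hz
    exact (Finset.prod_eq_zero (Finset.mem_univ i) (Set.indicator_of_notMem hi f)).symm

/-! ### Hellinger affinity and the two-point bound. -/

/-- Le Cam's inequality between the Hellinger affinity and the testing affinity. -/
theorem sq_lintegral_le_two_mul_lintegral_min {Z : Type*} [MeasurableSpace Z] (ν : Measure Z)
    {p q h : Z → ℝ≥0∞} (hp : Measurable p) (hq : Measurable q)
    (hh : ∀ z, h z ^ 2 ≤ p z * q z) (hp1 : ∫⁻ z, p z ∂ν = 1) (hq1 : ∫⁻ z, q z ∂ν = 1) :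
    (∫⁻ z, h z ∂ν) ^ 2 ≤ 2 * ∫⁻ z, min (p z) (q z) ∂ν := by
  have hsq : ∀ x : ℝ≥0∞, (x ^ (1 / 2 : ℝ)) ^ 2 = x := fun x => by
    rw [← ENNReal.rpow_natCast, ← ENNReal.rpow_mul]; norm_num
  have hmax : ∫⁻ z, max (p z) (q z) ∂ν ≤ 2 := by
    calc _ ≤ ∫⁻ z, (p z + q z) ∂ν := lintegral_mono fun z => max_le le_self_add le_add_self
      _ = 2 := by rw [lintegral_add_left hp, hp1, hq1]; norm_num
  -- Cauchy–Schwarz, using `√(p q) = √(min p q) * √(max p q)`.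
  have key : ∫⁻ z, h z ∂ν ≤
      (∫⁻ z, min (p z) (q z) ∂ν) ^ (1 / 2 : ℝ) * (∫⁻ z, max (p z) (q z) ∂ν) ^ (1 / 2 : ℝ) := by
    have hCS := ENNReal.lintegral_mul_le_Lp_mul_Lq ν Real.HolderConjugate.two_two
      (f := fun z => min (p z) (q z) ^ (1 / 2 : ℝ)) (g := fun z => max (p z) (q z) ^ (1 / 2 : ℝ))
      ((hp.min hq).pow_const _).aemeasurable ((hp.max hq).pow_const _).aemeasurable
    simp only [ENNReal.rpow_two, hsq] at hCS
    refine le_trans (lintegral_mono fun z => ?_) hCS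
    rw [Pi.mul_apply, ← ENNReal.mul_rpow_of_nonneg _ _ (by norm_num), min_mul_max]
    calc h z = (h z ^ 2) ^ (1 / 2 : ℝ) := by
          rw [← ENNReal.rpow_natCast, ← ENNReal.rpow_mul]; norm_num
      _ ≤ _ := ENNReal.rpow_le_rpow (hh z) (by norm_num)
  calc (∫⁻ z, h z ∂ν) ^ 2 ≤ _ := pow_le_pow_left' key 2
    _ = (∫⁻ z, min (p z) (q z) ∂ν) * ∫⁻ z, max (p z) (q z) ∂ν := by rw [mul_pow, hsq, hsq]
    _ ≤ _ := by rw [mul_comm]; gcongr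

/-- Completing the square: the geometric mean of two unit-variance Gaussian densities is the density
at the midpoint of the means, damped by `exp (-(a - b)² / 8)`. The damping factor is their Hellinger
affinity. -/
theorem gaussianPDFReal_mul_eq_sq (a b y : ℝ) :
    (Real.exp (-(a - b) ^ 2 / 8) * gaussianPDFReal ((a + b) / 2) 1 y) ^ 2 =
      gaussianPDFReal a 1 y * gaussianPDFReal b 1 y := by
  simp only [gaussianPDFReal, NNReal.coe_one, mul_one]
  have : ∀ s A B C D : ℝ, 2 * (A + B) = C + D →
      (Real.exp A * (s * Real.exp B)) ^ 2 = s * Real.exp C * (s * Real.exp D) := by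
    intro s A B C D h
    have h2 : Real.exp A ^ 2 * Real.exp B ^ 2 = Real.exp C * Real.exp D := by
      rw [← mul_pow, ← Real.exp_add, ← Real.exp_add, ← h, two_mul, Real.exp_add (A + B), pow_two,
        Real.exp_add]
    linear_combination s ^ 2 * h2
  apply this
  ring

theorem gaussianPDF_mul_eq_sq (a b y : ℝ) :
    (ENNReal.ofReal (Real.exp (-(a - b) ^ 2 / 8)) * gaussianPDF ((a + b) / 2) 1 y) ^ 2 =
      gaussianPDF a 1 y * gaussianPDF b 1 y := by
  simp only [gaussianPDF]
  rw [← ENNReal.ofReal_mul (Real.exp_nonneg _), ← ENNReal.ofReal_mul (gaussianPDFReal_nonneg _ _ _),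
    ← gaussianPDFReal_mul_eq_sq, ENNReal.ofReal_pow]
  exact mul_nonneg (Real.exp_nonneg _) (gaussianPDFReal_nonneg _ _ _)

theorem measurable_gaussianPDF_comp {d : ℕ} {f : cube d → ℝ} (hf : Measurable f) :
    Measurable fun p : cube d × ℝ => gaussianPDF (f p.1) 1 p.2 :=
  measurable_uncurry_gaussianPDF.comp
    ((hf.comp measurable_fst).prodMk (measurable_const.prodMk measurable_snd))

/-- Integrating out the response reduces the affinity of two regression laws to an integral over the
design. -/
theorem lintegral_mul_gaussianPDF {d : ℕ} (μ : Measure (cube d)) [IsProbabilityMeasure μ]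
    {f : cube d → ℝ} (hf : Measurable f) {w : cube d → ℝ≥0∞} (hw : Measurable w) :
    ∫⁻ p : cube d × ℝ, w p.1 * gaussianPDF (f p.1) 1 p.2 ∂(μ.prod volume) = ∫⁻ x, w x ∂μ := by
  rw [lintegral_prod (fun p : cube d × ℝ => w p.1 * gaussianPDF (f p.1) 1 p.2)
    ((hw.comp measurable_fst).mul (measurable_gaussianPDF_comp hf)).aemeasurable]
  refine lintegral_congr fun x => ?_
  simp only
  rw [lintegral_const_mul _ (measurable_gaussianPDF _ _),
    lintegral_gaussianPDF_eq_one _ one_ne_zero, mul_one]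

/-- Le Cam's two point lower bound for `n` independent observations, in terms of an affinity `h`
of the two densities. -/
theorem two_point_withDensity {E : Type*} [MeasurableSpace E] (ν : Measure E) [SigmaFinite ν]
    (n : ℕ) {p q h : E → ℝ≥0∞} (hp : Measurable p) (hq : Measurable q) (hh : Measurable h)
    (hpt : ∀ x, p x ≠ ∞) (hqt : ∀ x, q x ≠ ∞)
    (hp1 : ∫⁻ x, p x ∂ν = 1) (hq1 : ∫⁻ x, q x ∂ν = 1) (hhpq : ∀ x, h x ^ 2 ≤ p x * q x)
    {A B : (Fin n → E) → ℝ≥0∞} (hA : Measurable A) (c : ℝ≥0∞) (hc : ∀ z, c ≤ A z + B z) :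
    c * (((∫⁻ x, h x ∂ν) ^ n) ^ 2 / 2) ≤
      ∫⁻ z, A z ∂(Measure.pi fun _ : Fin n => ν.withDensity p) +
        ∫⁻ z, B z ∂(Measure.pi fun _ : Fin n => ν.withDensity q) := by
  have : IsProbabilityMeasure (ν.withDensity p) := ⟨by simpa using hp1⟩
  have : IsProbabilityMeasure (ν.withDensity q) := ⟨by simpa using hq1⟩
  rw [pi_withDensity_eq ν n p hp, pi_withDensity_eq ν n q hq]
  have mprod : ∀ {r : E → ℝ≥0∞}, Measurable r →
      Measurable fun z : Fin n → E => ∏ i, r (z i) := fun hr =>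
    Finset.measurable_fun_prod _ fun i _ => hr.comp (measurable_pi_apply i)
  have hint : ∀ {r : E → ℝ≥0∞}, Measurable r →
      ∫⁻ z, ∏ i, r (z i) ∂(Measure.pi fun _ : Fin n => ν) = (∫⁻ x, r x ∂ν) ^ n := fun {r} hr => by
    simpa using lintegral_pi_prod_eq_prod ν (n := n) (fun _ => r) fun _ => hr
  have aff := sq_lintegral_le_two_mul_lintegral_min (Measure.pi fun _ : Fin n => ν)
    (mprod hp) (mprod hq) (h := fun z => ∏ i, h (z i))
    (fun z => by
      rw [← Finset.prod_pow, ← Finset.prod_mul_distrib]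
      exact Finset.prod_le_prod' fun i _ => hhpq (z i))
    (by rw [hint hp, hp1, one_pow]) (by rw [hint hq, hq1, one_pow])
  rw [hint hh] at aff
  have hdens : ∀ {r : E → ℝ≥0∞} (U : (Fin n → E) → ℝ≥0∞), Measurable r → (∀ x, r x ≠ ∞) →
      ∫⁻ z, U z ∂((Measure.pi fun _ : Fin n => ν).withDensity fun z => ∏ i, r (z i)) =
        ∫⁻ z, (∏ i, r (z i)) * U z ∂(Measure.pi fun _ : Fin n => ν) := fun U hr ht =>
    lintegral_withDensity_eq_lintegral_mul_non_measurable _ (mprod hr)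
      (Filter.Eventually.of_forall fun z => (ENNReal.prod_ne_top fun i _ => ht _).lt_top) _
  rw [hdens A hp hpt, hdens B hq hqt,
    ← lintegral_add_left (f := fun z => (∏ i, p (z i)) * A z) ((mprod hp).mul hA)]
  calc _ ≤ c * ∫⁻ z, min (∏ i, p (z i)) (∏ i, q (z i)) ∂(Measure.pi fun _ : Fin n => ν) := by
        gcongr
        exact ENNReal.div_le_of_le_mul (by rwa [mul_comm])
    _ = ∫⁻ z, c * min (∏ i, p (z i)) (∏ i, q (z i)) ∂(Measure.pi fun _ : Fin n => ν) :=
        (lintegral_const_mul _ ((mprod hp).min (mprod hq))).symm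
    _ ≤ _ := lintegral_mono fun z => by
        calc c * min (∏ i, p (z i)) (∏ i, q (z i))
            ≤ (A z + B z) * min (∏ i, p (z i)) (∏ i, q (z i)) := by gcongr; exact hc z
          _ = min (∏ i, p (z i)) (∏ i, q (z i)) * A z +
              min (∏ i, p (z i)) (∏ i, q (z i)) * B z := by ring
          _ ≤ _ := by gcongr; exacts [min_le_left _ _, min_le_right _ _]

/-- The two point lower bound for `n` Gaussian regression observations. -/
theorem two_point_obsLaw {d : ℕ} (n : ℕ) (μ : Measure (cube d)) [IsProbabilityMeasure μ]
    {f g : cube d → ℝ} (hf : Measurable f) (hg : Measurable g)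
    {A B : (Fin n → cube d × ℝ) → ℝ≥0∞} (hA : Measurable A)
    (c : ℝ≥0∞) (hc : ∀ z, c ≤ A z + B z) :
    c * (((∫⁻ x, ENNReal.ofReal (Real.exp (-(f x - g x) ^ 2 / 8)) ∂μ) ^ n) ^ 2 / 2) ≤
      ∫⁻ z, A z ∂(Measure.pi fun _ : Fin n => obsLaw μ f) +
        ∫⁻ z, B z ∂(Measure.pi fun _ : Fin n => obsLaw μ g) := by
  have hone : ∀ {u : cube d → ℝ}, Measurable u →
      ∫⁻ p : cube d × ℝ, gaussianPDF (u p.1) 1 p.2 ∂(μ.prod volume) = 1 := fun {u} hu => by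
    simpa using lintegral_mul_gaussianPDF μ hu (w := fun _ => 1) measurable_const
  have mw : Measurable fun x => ENNReal.ofReal (Real.exp (-(f x - g x) ^ 2 / 8)) := by fun_prop
  have hmid : Measurable fun x => (f x + g x) / 2 := by fun_prop
  have := two_point_withDensity (μ.prod volume) n (measurable_gaussianPDF_comp hf)
    (measurable_gaussianPDF_comp hg)
    ((mw.comp measurable_fst).mul (measurable_gaussianPDF_comp hmid))
    (fun _ => gaussianPDF_ne_top) (fun _ => gaussianPDF_ne_top) (hone hf) (hone hg)
    (fun p => (gaussianPDF_mul_eq_sq (f p.1) (g p.1) p.2).le) hA c hc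
  rw [← lintegral_mul_gaussianPDF μ hmid mw]
  exact this

/-- Combines `exp (-t) ≥ 1 - t` with Bernoulli's inequality. With `w = (f - g)²` it says that two
functions at squared `L²(μ)` distance at most `1 / n` remain indistinguishable from `n`
observations. -/
theorem sq_pow_affinity_ge {d n : ℕ} (hn : 1 ≤ n) (μ : Measure (cube d)) [IsProbabilityMeasure μ]
    {w : cube d → ℝ} (hw : Integrable w μ) (hw0 : ∀ x, 0 ≤ w x) (hs : n * ∫ x, w x ∂μ ≤ 1) :
    1 / 2 ≤ ((∫⁻ x, ENNReal.ofReal (Real.exp (-(w x) / 8)) ∂μ) ^ n) ^ 2 := by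
  have hI0 : 0 ≤ ∫ x, w x ∂μ := integral_nonneg hw0
  set s := ∫ x, w x ∂μ with hsdef
  have hs1 : s ≤ 1 := by
    have : (1 : ℝ) ≤ n := by exact_mod_cast hn
    nlinarith
  have h1 : ENNReal.ofReal (1 - s / 8) ≤
      ∫⁻ x, ENNReal.ofReal (Real.exp (-(w x) / 8)) ∂μ := by
    have hint : Integrable (fun x => 1 - w x / 8) μ := (integrable_const _).sub (hw.div_const 8)
    have : 1 - s / 8 = ∫ x, (1 - w x / 8) ∂μ := by
      rw [integral_sub (integrable_const _) (hw.div_const 8), integral_div]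
      simp [hsdef]
    have hexp : Integrable (fun x => Real.exp (-(w x) / 8)) μ :=
      Integrable.of_bound
        (Real.continuous_exp.comp_aestronglyMeasurable (hw.neg.div_const 8).aestronglyMeasurable) 1
        (Filter.Eventually.of_forall fun x => by
          rw [Real.norm_of_nonneg (Real.exp_nonneg _), Real.exp_le_one_iff]
          linarith [hw0 x])
    rw [this, ← ofReal_integral_eq_lintegral_ofReal hexp
      (Filter.Eventually.of_forall fun x => Real.exp_nonneg _)]
    refine ENNReal.ofReal_le_ofReal (integral_mono hint hexp fun x => ?_)
    have := Real.add_one_le_exp (-(w x) / 8)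
    simp only
    linarith
  have h2 : (1 : ℝ) / 2 ≤ ((1 - s / 8) ^ n) ^ 2 := by
    -- As `n * s ≤ 1`, the power is at least `1 - 1 / 8`, and `(7 / 8)² ≥ 1 / 2`.
    have hb := one_add_mul_le_pow (a := -(s / 8)) (by linarith) n
    have : (7 : ℝ) / 8 ≤ (1 - s / 8) ^ n := by
      rw [sub_eq_add_neg]; refine le_trans ?_ hb; nlinarith
    nlinarith
  calc (1 / 2 : ℝ≥0∞) = ENNReal.ofReal (1 / 2) := by
        rw [ENNReal.ofReal_div_of_pos two_pos]; simp
    _ ≤ ENNReal.ofReal (((1 - s / 8) ^ n) ^ 2) := ENNReal.ofReal_le_ofReal h2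
    _ = (ENNReal.ofReal (1 - s / 8) ^ n) ^ 2 := by
        rw [ENNReal.ofReal_pow (pow_nonneg (by linarith) n), ENNReal.ofReal_pow (by linarith)]
    _ ≤ _ := by gcongr

/-! ### Assouad's lemma. -/

/-- Assouad's lemma for regression functions `∑ k, ω k * a k * ψ k`, `ω ∈ {0,1}^J`, where `ψ k`
is `1` on the `k`-th of a family of disjoint cells. -/
theorem assouad_minimaxL2Risk {d n : ℕ} (hn : 1 ≤ n) {J : Type*} [Fintype J]
    (μ : Measure (cube d)) [IsProbabilityMeasure μ] (F : Set (cube d → ℝ))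
    (ψ : J → cube d → ℝ) (hψ : ∀ k, Measurable (ψ k)) (P : J → Set (cube d))
    (hP : ∀ k, MeasurableSet (P k)) (hdisj : Pairwise fun k l => Disjoint (P k) (P l))
    (a : J → ℝ) (h1 : ∀ k, ∀ x ∈ P k, ψ k x = 1)
    (hF : ∀ ω : J → Bool, (fun x => ∑ k, (if ω k then a k else 0) * ψ k x) ∈ F)
    (hint : ∀ k, Integrable (fun x => ψ k x ^ 2) μ)
    (hs : ∀ k, n * (a k ^ 2 * ∫ x, ψ k x ^ 2 ∂μ) ≤ 1) :
    ENNReal.ofReal (∑ k, a k ^ 2 * μ.real (P k) / 16) ≤ minimaxL2Risk n μ F := by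
  classical
  refine le_iInf₂ fun T hT => ?_
  set f : (J → Bool) → cube d → ℝ := fun ω x => ∑ k, (if ω k then a k else 0) * ψ k x with hf
  have hfm : ∀ ω, Measurable (f ω) := fun ω =>
    Finset.measurable_fun_sum _ fun k _ => (hψ k).const_mul _
  set S := ⨆ f ∈ F, l2Risk n μ f T
  let G : J → (J → Bool) → (Fin n → cube d × ℝ) → ℝ≥0∞ := fun k ω z =>
    ∫⁻ x in P k, ENNReal.ofReal ((T z x - f ω x) ^ 2) ∂μ
  have hG0 : ∀ ω, Measurable (Function.uncurry fun (z : Fin n → cube d × ℝ) x =>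
      ENNReal.ofReal ((T z x - f ω x) ^ 2)) := fun ω =>
    ((hT.sub ((hfm ω).comp measurable_snd)).pow_const 2).ennreal_ofReal
  have hG : ∀ k ω, Measurable (G k ω) := fun k ω => (hG0 ω).lintegral_prod_right
  let R : J → (J → Bool) → ℝ≥0∞ := fun k ω =>
    ∫⁻ z, G k ω z ∂(Measure.pi fun _ : Fin n => obsLaw μ (f ω))
  have hR : ∀ ω, ∑ k, R k ω ≤ S := fun ω => by
    -- The cells are disjoint, so the local losses add up to at most the total loss; they need not
    -- cover the cube.
    refine le_trans ?_ (le_iSup₂ (f := fun f _ => l2Risk n μ f T) (f ω) (hF ω))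
    simp only [R, l2Risk]
    rw [← lintegral_finsetSum _ fun k _ => hG k ω]
    refine lintegral_mono fun z => ?_
    simp only [G]
    rw [← tsum_fintype (L := .unconditional _), ← lintegral_iUnion hP hdisj]
    exact setLIntegral_le_lintegral _ _
  let flip : J → Equiv.Perm (J → Bool) := fun k =>
    Function.Involutive.toPerm (fun ω => Function.update ω k (!ω k)) fun ω => by simp
  have hflip : ∀ k ω, flip k ω = Function.update ω k (!ω k) := fun _ _ => rfl
  have hdiff : ∀ k ω x, (f ω x - f (flip k ω) x) ^ 2 = a k ^ 2 * ψ k x ^ 2 := fun k ω x => by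
    have : f ω x - f (flip k ω) x =
        ((if ω k then a k else 0) - (if !ω k then a k else 0)) * ψ k x := by
      simp only [hf, ← Finset.sum_sub_distrib, ← sub_mul]
      rw [Finset.sum_eq_single k]
      · simp [hflip]
      · intro l _ hl
        simp [hflip, Function.update_of_ne hl]
      · simp
    rw [this]
    cases ω k <;> simp <;> ring
  have hpair : ∀ k ω, ENNReal.ofReal (a k ^ 2 * μ.real (P k) / 8) ≤
      R k ω + R k (flip k ω) := fun k ω => by
    have h2 := two_point_obsLaw n μ (hfm ω) (hfm (flip k ω)) (hG k ω) (B := G k (flip k ω))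
      (ENNReal.ofReal (a k ^ 2 / 2) * μ (P k)) fun z => by
        rw [← setLIntegral_const]
        simp only [G]
        rw [← lintegral_add_left ((hG0 ω).of_uncurry_left (x := z))]
        refine setLIntegral_mono' (hP k) fun x hx => ?_
        rw [← ENNReal.ofReal_add (sq_nonneg _) (sq_nonneg _)]
        refine ENNReal.ofReal_le_ofReal ?_
        have := hdiff k ω x
        rw [h1 k x hx] at this
        -- `u² + v² ≥ (u - v)² / 2`: no estimate is close to both functions on the cell.
        nlinarith [sq_nonneg ((T z x - f ω x) + (T z x - f (flip k ω) x))]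
    refine le_trans ?_ h2
    simp_rw [hdiff]
    have h3 := sq_pow_affinity_ge hn μ ((hint k).const_mul (a k ^ 2)) (fun x => by positivity)
      (by rw [integral_const_mul]; exact hs k)
    calc ENNReal.ofReal (a k ^ 2 * μ.real (P k) / 8)
        = ENNReal.ofReal (a k ^ 2 / 2) * μ (P k) * (1 / 2 / 2) := by
          rw [← ofReal_measureReal (measure_ne_top _ _), ← ENNReal.ofReal_mul (by positivity)]
          have : (1 / 2 / 2 : ℝ≥0∞) = ENNReal.ofReal (1 / 2 / 2) := by
            rw [ENNReal.ofReal_div_of_pos two_pos, ENNReal.ofReal_div_of_pos two_pos]; simp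
          rw [this, ← ENNReal.ofReal_mul (by positivity)]
          congr 1; ring
      _ ≤ _ := by gcongr
  -- `flip k` permutes the hypercube, so summing the pair bounds counts each `R k ω` twice. This
  -- turns the `8` into the final `16`.
  have hsum : ∀ k, (Fintype.card (J → Bool) : ℝ≥0∞) *
      ENNReal.ofReal (a k ^ 2 * μ.real (P k) / 8) ≤ 2 * ∑ ω, R k ω := fun k => by
    calc _ = ∑ _ω : J → Bool, ENNReal.ofReal (a k ^ 2 * μ.real (P k) / 8) := by
          simp [Finset.sum_const, Finset.card_univ]
      _ ≤ ∑ ω, (R k ω + R k (flip k ω)) := Finset.sum_le_sum fun ω _ => hpair k ω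
      _ = _ := by
          rw [Finset.sum_add_distrib, Equiv.sum_comp (flip k) (R k), two_mul]
  have hcard : (Fintype.card (J → Bool) : ℝ≥0∞) ≠ 0 := by simp
  have hcard' : (Fintype.card (J → Bool) : ℝ≥0∞) ≠ ∞ := ENNReal.natCast_ne_top _
  have htot : (Fintype.card (J → Bool) : ℝ≥0∞) *
      ENNReal.ofReal (∑ k, a k ^ 2 * μ.real (P k) / 8) ≤ Fintype.card (J → Bool) * (2 * S) := by
    rw [ENNReal.ofReal_sum_of_nonneg fun k _ => by positivity, Finset.mul_sum]
    calc _ ≤ ∑ k, 2 * ∑ ω, R k ω := Finset.sum_le_sum fun k _ => hsum k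
      _ = 2 * ∑ ω, ∑ k, R k ω := by rw [← Finset.mul_sum, Finset.sum_comm]
      _ ≤ 2 * ∑ _ω : J → Bool, S := by gcongr with ω; exact hR ω
      _ = _ := by
        rw [Finset.sum_const, Finset.card_univ, nsmul_eq_mul]; ring
  rw [ENNReal.mul_le_mul_iff_right hcard hcard'] at htot
  have h16 : ∑ k, a k ^ 2 * μ.real (P k) / 8 = 2 * ∑ k, a k ^ 2 * μ.real (P k) / 16 := by
    rw [Finset.mul_sum]; exact Finset.sum_congr rfl fun k _ => by ring
  rw [h16, ENNReal.ofReal_mul two_pos.le, ENNReal.ofReal_ofNat,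
    ENNReal.mul_le_mul_iff_right two_ne_zero ENNReal.ofNat_ne_top] at htot
  exact htot

/-! ### Choice of a good block of coordinates. -/

/-- Jensen's inequality, in the form `E[1 / w] ≥ exp (-E[log w])`. -/
theorem exp_neg_sum_mul_log_le {ι : Type*} [Fintype ι] {P w : ι → ℝ} (hP : ∀ i, 0 ≤ P i)
    (hP1 : ∑ i, P i = 1) (hw : ∀ i, 0 < w i) :
    Real.exp (-∑ i, P i * Real.log (w i)) ≤ ∑ i, P i / w i := by
  have := convexOn_exp.map_sum_le (t := Finset.univ) (w := P) (p := fun i => -Real.log (w i))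
    (fun i _ => hP i) hP1 fun i _ => Set.mem_univ _
  simp only [smul_eq_mul, mul_neg, Finset.sum_neg_distrib, Real.exp_neg, Real.exp_log (hw _)] at this
  rw [Real.exp_neg]
  simpa [div_eq_mul_inv] using this

theorem sum_mul_log_le_log_sum {ι : Type*} [Fintype ι] {P w : ι → ℝ} (hP : ∀ i, 0 ≤ P i)
    (hP1 : ∑ i, P i = 1) (hw : ∀ i, 0 < w i) :
    ∑ i, P i * Real.log (w i) ≤ Real.log (∑ i, P i * w i) := by
  simpa using strictConcaveOn_log_Ioi.concaveOn.le_map_sum (t := Finset.univ) (w := P) (p := w)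
    (fun i _ => hP i) hP1 fun i _ => hw i

/-- A weight on a product of finite sets, bounded by `(A / m)^d`, has among the marginals on `q`
disjoint blocks of `s` coordinates one which is not too concentrated. -/
theorem exists_block {d q s m : ℕ} (hq : 0 < q) (hm : 0 < m) (hqs : q * s ≤ d) (hd : d ≤ 2 * q * s)
    {A W : ℝ} (hA : 1 ≤ A) (hW : 0 < W) {P : (Fin d → Fin m) → ℝ} (hP : ∀ i, 0 ≤ P i)
    (hP1 : ∑ i, P i = 1) (hPA : ∀ i, P i ≤ (A / m) ^ d)
    (w : (Fin s → Fin d) → (Fin s → Fin m) → ℝ) (hw : ∀ e k, 0 < w e k)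
    (hwW : ∀ e, Function.Injective e → ∑ k, w e k ≤ W * (m : ℝ) ^ s) :
    ∃ e : Fin s → Fin d, Function.Injective e ∧
      (A ^ (2 * s) * W)⁻¹ ≤ ∑ i, P i / w e (i ∘ e) := by
  -- Splits the coordinates into `q` blocks of size `s` and a remainder.
  obtain ⟨E⟩ : Nonempty (((Fin q × Fin s) ⊕ Fin (d - q * s)) ≃ Fin d) :=
    ⟨Fintype.equivOfCardEq (by simp; omega)⟩
  let e : Fin q → Fin s → Fin d := fun b j => E (Sum.inl (b, j))
  have he : ∀ b, Function.Injective (e b) := fun b j j' h => by simpa [e] using h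
  have hmR : (0 : ℝ) < m := by exact_mod_cast hm
  -- Against counting measure the blocks are independent, and each remaining coordinate gives a
  -- factor `m`. The bound `hPA` then transfers this to `P` at the cost of `A ^ d`, once for all `q`
  -- blocks together.
  have hprod : ∑ i : Fin d → Fin m, ∏ b, w (e b) (i ∘ e b) =
      (m : ℝ) ^ (d - q * s) * ∏ b, ∑ k, w (e b) k := by
    rw [Finset.prod_univ_sum, Fintype.piFinset_univ]
    let Φ : (Fin d → Fin m) ≃ (Fin q → Fin s → Fin m) × (Fin (d - q * s) → Fin m) :=
      (Equiv.arrowCongr E.symm (Equiv.refl _)).trans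
        ((Equiv.sumArrowEquivProdArrow _ _ _).trans
          (Equiv.prodCongr (Equiv.curry _ _ _) (Equiv.refl _)))
    rw [Fintype.sum_equiv Φ _ (fun z => ∏ b, w (e b) (z.1 b)) fun i => ?_]
    · rw [Fintype.sum_prod_type]
      simp [Finset.mul_sum]
    · refine Finset.prod_congr rfl fun b _ => ?_
      congr 1
  have hEW : ∑ i, P i * ∏ b, w (e b) (i ∘ e b) ≤ A ^ d * W ^ q := by
    calc _ ≤ ∑ i : Fin d → Fin m, (A / m) ^ d * ∏ b, w (e b) (i ∘ e b) :=
          Finset.sum_le_sum fun i _ => mul_le_mul_of_nonneg_right (hPA i)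
            (Finset.prod_nonneg fun b _ => (hw _ _).le)
      _ = (A / m) ^ d * ((m : ℝ) ^ (d - q * s) * ∏ b, ∑ k, w (e b) k) := by
          rw [← Finset.mul_sum, hprod]
      _ ≤ (A / m) ^ d * ((m : ℝ) ^ (d - q * s) * ∏ _b : Fin q, (W * (m : ℝ) ^ s)) := by
          gcongr with b
          · exact fun b _ => Finset.sum_nonneg fun k _ => (hw _ _).le
          · exact hwW _ (he b)
      _ = A ^ d * W ^ q := by
          rw [Finset.prod_const, Finset.card_univ, Fintype.card_fin, mul_pow, ← pow_mul, div_pow]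
          have : (m : ℝ) ^ d = (m : ℝ) ^ (d - q * s) * (m : ℝ) ^ (s * q) := by
            rw [← pow_add]; congr 1; rw [mul_comm s q]; omega
          rw [this]
          field_simp
  have hlog : ∑ b, ∑ i, P i * Real.log (w (e b) (i ∘ e b)) ≤
      d * Real.log A + q * Real.log W := by
    rw [Finset.sum_comm]
    simp_rw [← Finset.mul_sum]
    have hpos : ∀ i : Fin d → Fin m, 0 < ∏ b, w (e b) (i ∘ e b) := fun i =>
      Finset.prod_pos fun b _ => hw _ _
    calc _ = ∑ i, P i * Real.log (∏ b, w (e b) (i ∘ e b)) := by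
          refine Finset.sum_congr rfl fun i _ => ?_
          rw [Real.log_prod fun b _ => (hw _ _).ne']
      _ ≤ Real.log (∑ i, P i * ∏ b, w (e b) (i ∘ e b)) := sum_mul_log_le_log_sum hP hP1 hpos
      _ ≤ Real.log (A ^ d * W ^ q) := by
          refine Real.log_le_log ?_ hEW
          obtain ⟨i, -, hi⟩ : ∃ i ∈ Finset.univ, P i ≠ 0 :=
            Finset.exists_ne_zero_of_sum_ne_zero (by rw [hP1]; exact one_ne_zero)
          exact Finset.sum_pos' (fun i _ => mul_nonneg (hP i) (hpos i).le)
            ⟨i, Finset.mem_univ i, mul_pos (lt_of_le_of_ne (hP i) hi.symm) (hpos i)⟩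
      _ = _ := by
          rw [Real.log_mul (by positivity) (by positivity), Real.log_pow, Real.log_pow]
  have hqR : (0 : ℝ) < q := by exact_mod_cast hq
  -- The best block does at least as well as the average, and `d / q ≤ 2 * s`.
  obtain ⟨b, hb⟩ : ∃ b, ∑ i, P i * Real.log (w (e b) (i ∘ e b)) ≤
      2 * s * Real.log A + Real.log W := by
    by_contra! hcon
    have : NeZero q := ⟨hq.ne'⟩
    have := Finset.sum_lt_sum_of_nonempty (s := Finset.univ) ⟨(0 : Fin q), Finset.mem_univ _⟩
      fun b _ => hcon b
    rw [Finset.sum_const, Finset.card_univ, Fintype.card_fin, nsmul_eq_mul] at this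
    have hd' : (d : ℝ) ≤ 2 * q * s := by exact_mod_cast hd
    nlinarith [mul_le_mul_of_nonneg_right hd' (Real.log_nonneg hA)]
  refine ⟨e b, he b, le_trans ?_ (exp_neg_sum_mul_log_le hP hP1 fun i => hw _ _)⟩
  rw [← Real.exp_log (show 0 < (A ^ (2 * s) * W)⁻¹ by positivity), Real.exp_le_exp, Real.log_inv,
    Real.log_mul (by positivity) (by positivity), Real.log_pow]
  push_cast
  linarith

/-! ### A plateau function and its integer translates. -/

/-- At most three integers lie within distance `1` of `t`. -/
theorem sum_abs_translates_le {F : ℝ → ℝ} {K : ℝ} (hK : 0 ≤ K) (hF : ∀ t, |F t| ≤ K)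
    (hF0 : ∀ t, 1 < |t| → F t = 0) (m : ℕ) (t : ℝ) : ∑ l : Fin m, |F (t - l)| ≤ 3 * K := by
  classical
  let s : Finset (Fin m) := {l | |t - (l : ℕ)| ≤ 1}
  have hs : s.card ≤ 3 := by
    have hle : s.card ≤ (Finset.Icc ⌈t - 1⌉ ⌊t + 1⌋).card := by
      refine Finset.card_le_card_of_injOn (fun l => ((l : ℕ) : ℤ)) (fun l hl => ?_) ?_
      · have := (Finset.mem_filter.1 hl).2
        rw [abs_le] at this
        simp only [Finset.coe_Icc, Set.mem_Icc, Int.ceil_le, Int.le_floor]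
        push_cast
        constructor <;> linarith
      · intro l _ l' _ h
        simpa [Fin.ext_iff] using h
    refine hle.trans ?_
    have h1 := Int.floor_le (t + 1)
    have h2 := Int.le_ceil (t - 1)
    have h3 : ((⌊t + 1⌋ - ⌈t - 1⌉ : ℤ) : ℝ) ≤ (2 : ℤ) := by push_cast; linarith
    have h4 := Int.cast_le.1 h3
    rw [Int.card_Icc]
    omega
  calc ∑ l : Fin m, |F (t - l)| = ∑ l ∈ s, |F (t - l)| := by
        refine (Finset.sum_subset (Finset.subset_univ s) fun l _ hl => ?_).symm
        rw [hF0, abs_zero]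
        simpa [s] using hl
    _ ≤ s.card • K := Finset.sum_le_card_nsmul _ _ _ fun l _ => hF _
    _ ≤ 3 * K := by
        rw [nsmul_eq_mul]
        gcongr
        exact_mod_cast hs

/-- A smooth plateau function together with a bound for the sums of the translates of its
derivatives. -/
theorem exists_plateau (L : ℕ) : ∃ (φ : ℝ → ℝ) (B : ℝ), 1 ≤ B ∧ ContDiff ℝ (⊤ : ℕ∞) φ ∧
    (∀ t, |t| ≤ 1 / 2 → φ t = 1) ∧
    (∀ a ≤ L, ∀ (m : ℕ) (t : ℝ), ∑ l : Fin m, |iteratedDeriv a φ (t - l)| ≤ B) ∧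
    ∀ (m : ℕ) (t : ℝ), ∑ l : Fin m, φ (t - l) ^ 2 ≤ B := by
  let b : ContDiffBump (0 : ℝ) := ⟨1 / 2, 1, by norm_num, by norm_num⟩
  have hb : ContDiff ℝ (⊤ : ℕ∞) (b : ℝ → ℝ) := b.contDiff
  have hsupp : ∀ a t, 1 < |t| → iteratedDeriv a b t = 0 := fun a t ht => by
    by_contra h
    have hmem : t ∈ Function.support (iteratedFDeriv ℝ a b) := fun h0 => h (by
      rw [iteratedDeriv_eq_iteratedFDeriv, h0]; rfl)
    have := support_iteratedFDeriv_subset a hmem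
    rw [b.tsupport_eq, mem_closedBall_zero_iff, Real.norm_eq_abs] at this
    exact absurd (this.trans_lt ht) (lt_irrefl _)
  have hbd : ∀ a, ∃ K, ∀ t, |iteratedDeriv a b t| ≤ K := fun a => by
    have hc : HasCompactSupport (iteratedDeriv a b) :=
      HasCompactSupport.intro (isCompact_closedBall (0 : ℝ) 1) fun t ht => hsupp a t (by simpa using ht)
    obtain ⟨K, hK⟩ := hc.exists_bound_of_continuous
      (hb.continuous_iteratedDeriv a (by exact_mod_cast le_top))
    exact ⟨K, hK⟩
  choose K hK using hbd
  have hK0 : ∀ a, 0 ≤ K a := fun a => (abs_nonneg _).trans (hK a 0)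
  -- A single constant serves all orders up to `L`. The case `a = 0` also covers the sum of squares,
  -- because `0 ≤ b ≤ 1`.
  have hbound : ∀ a ≤ L, ∀ (m : ℕ) (t : ℝ),
      ∑ l : Fin m, |iteratedDeriv a b (t - l)| ≤ 1 + ∑ a ∈ Finset.range (L + 1), 3 * K a := by
    intro a ha m t
    have := Finset.single_le_sum (f := fun a => 3 * K a) (s := Finset.range (L + 1))
      (fun a _ => mul_nonneg (by norm_num) (hK0 a)) (Finset.mem_range_succ_iff.2 ha)
    linarith [sum_abs_translates_le (hK0 a) (hK a) (hsupp a) m t]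
  refine ⟨b, 1 + ∑ a ∈ Finset.range (L + 1), 3 * K a, ?_, hb, fun t ht => ?_, hbound, fun m t => ?_⟩
  · have : 0 ≤ ∑ a ∈ Finset.range (L + 1), 3 * K a :=
      Finset.sum_nonneg fun a _ => mul_nonneg (by norm_num) (hK0 a)
    linarith
  · exact b.one_of_mem_closedBall (by simpa [b] using ht)
  · refine le_trans (Finset.sum_le_sum fun l _ => ?_) (hbound 0 (Nat.zero_le _) m t)
    rw [iteratedDeriv_zero, abs_of_nonneg b.nonneg, sq]
    exact mul_le_of_le_one_left b.nonneg b.le_one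

/-! ### Derivatives and Hölder norms of sums of tensor bumps. -/

theorem sum_update_add_one {ι : Type*} [Fintype ι] [DecidableEq ι] (α : ι → ℕ) (i : ι) :
    ∑ j, Function.update α i (α i + 1) j = ∑ j, α j + 1 := by
  rw [Finset.sum_update_of_mem (Finset.mem_univ _),
    ← Finset.add_sum_erase Finset.univ α (Finset.mem_univ i), Finset.sdiff_singleton_eq_erase]
  ring

/-- The linear combination with coefficients `c` of the `α`-th partial derivatives of the tensor
product bumps `x ↦ ∏ j, φ (m (x j + 1) / 2 - 1 / 2 - k j)`. -/
noncomputable def bumpSum (φ : ℝ → ℝ) {r m : ℕ} (c : (Fin r → Fin m) → ℝ) (α : Fin r → ℕ)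
    (x : Fin r → ℝ) : ℝ :=
  ∑ k, c k * ∏ j, ((m / 2 : ℝ) ^ α j *
    iteratedDeriv (α j) φ ((m / 2 : ℝ) * (x j + 1) - 1 / 2 - (k j : ℕ)))

section bumpSum

variable {φ : ℝ → ℝ} {r m : ℕ} {c : (Fin r → Fin m) → ℝ}

theorem contDiff_bumpSum (hφ : ContDiff ℝ (⊤ : ℕ∞) φ) (α : Fin r → ℕ) :
    ContDiff ℝ (⊤ : ℕ∞) (bumpSum φ c α) := by
  refine ContDiff.sum fun k _ => contDiff_const.mul (contDiff_prod fun j _ => contDiff_const.mul ?_)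
  have h : ContDiff ℝ (⊤ : ℕ∞) (iteratedDeriv (α j) φ) := by
    rw [iteratedDeriv_eq_iterate]
    exact hφ.iterate_deriv _
  refine h.comp ?_
  fun_prop

/-- Along the `i`-th axis only the `i`-th factor of each product moves, so the family `bumpSum φ c`
is closed under partial derivatives. -/
theorem fderiv_bumpSum_single (hφ : ContDiff ℝ (⊤ : ℕ∞) φ) (α : Fin r → ℕ) (x : Fin r → ℝ)
    (i : Fin r) :
    fderiv ℝ (bumpSum φ c α) x (Pi.single i 1) = bumpSum φ c (Function.update α i (α i + 1)) x := by
  have h1 : HasDerivAt (fun t : ℝ => bumpSum φ c α (x + t • Pi.single i (1 : ℝ)))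
      (fderiv ℝ (bumpSum φ c α) x (Pi.single i 1)) 0 := by
    have hd := (((contDiff_bumpSum (c := c) hφ α).differentiable (by simp)) x).hasFDerivAt
    exact hd.hasLineDerivAt _
  refine h1.unique ?_
  unfold bumpSum
  refine HasDerivAt.fun_sum fun k _ => HasDerivAt.const_mul _ ?_
  have hj : ∀ j ≠ i, ∀ t : ℝ, (x + t • (Pi.single i (1 : ℝ) : Fin r → ℝ)) j = x j := fun j hj t => by
    simp [hj]
  rw [← Finset.mul_prod_erase Finset.univ _ (Finset.mem_univ i)]
  have hprod : ∀ t : ℝ, ∏ j, ((m / 2 : ℝ) ^ α j * iteratedDeriv (α j) φ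
        ((m / 2 : ℝ) * ((x + t • (Pi.single i (1 : ℝ) : Fin r → ℝ)) j + 1) - 1 / 2 - (k j : ℕ))) =
      ((m / 2 : ℝ) ^ α i * iteratedDeriv (α i) φ
        ((m / 2 : ℝ) * (x i + t + 1) - 1 / 2 - (k i : ℕ))) *
      ∏ j ∈ Finset.univ.erase i, ((m / 2 : ℝ) ^ (Function.update α i (α i + 1)) j *
        iteratedDeriv ((Function.update α i (α i + 1)) j) φ
          ((m / 2 : ℝ) * (x j + 1) - 1 / 2 - (k j : ℕ))) := fun t => by
    rw [← Finset.mul_prod_erase Finset.univ _ (Finset.mem_univ i)]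
    congr 1
    · simp
    · refine Finset.prod_congr rfl fun j hj' => ?_
      rw [hj j (Finset.ne_of_mem_erase hj'), Function.update_of_ne (Finset.ne_of_mem_erase hj')]
  simp_rw [hprod]
  refine HasDerivAt.mul_const ?_ _
  rw [Function.update_self, pow_succ, mul_assoc]
  refine HasDerivAt.const_mul _ ?_
  have hdiff : Differentiable ℝ (iteratedDeriv (α i) φ) :=
    hφ.differentiable_iteratedDeriv _ (by exact_mod_cast ENat.natCast_lt_top _)
  have hin : HasDerivAt (fun t : ℝ => (m / 2 : ℝ) * (x i + t + 1) - 1 / 2 - (k i : ℕ)) (m / 2) 0 := by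
    simpa using ((((hasDerivAt_id (0 : ℝ)).const_add (x i)).add_const 1).const_mul
      (m / 2 : ℝ)).sub_const (1 / 2) |>.sub_const ((k i : ℕ) : ℝ)
  have := HasDerivAt.comp (0 : ℝ) (hdiff _).hasDerivAt hin
  rw [← iteratedDeriv_succ, add_zero, mul_comm] at this
  exact this

/-- Recording only the total order of `α` suffices: the bounds below depend on nothing else. -/
theorem iteratedFDeriv_bumpSum_single (hφ : ContDiff ℝ (⊤ : ℕ∞) φ) {n : ℕ} (i : Fin n → Fin r) :
    ∃ α : Fin r → ℕ, ∑ j, α j = n ∧ ∀ x,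
      iteratedFDeriv ℝ n (bumpSum φ c 0) x (fun j => Pi.single (i j) (1 : ℝ)) =
        bumpSum φ c α x := by
  induction n with
  | zero => exact ⟨0, by simp, fun x => by simp⟩
  | succ n ih =>
    obtain ⟨α, hα, h⟩ := ih (Fin.tail i)
    refine ⟨Function.update α (i 0) (α (i 0) + 1), ?_, fun x => ?_⟩
    · exact (sum_update_add_one α (i 0)).trans (congrArg (· + 1) hα)
    · rw [DifferentiableAt.iteratedFDeriv_succ_apply_left', ← fderiv_bumpSum_single hφ]
      · congr 2
        exact funext h
      · exact ((contDiff_bumpSum hφ 0).differentiable_iteratedFDeriv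
          (by exact_mod_cast ENat.natCast_lt_top _)) x

/-- After taking absolute values, the sum over the grid factorises into `r` one-variable sums.
Overlaps of the bumps thus cost `B ^ r`, whatever `m` is. -/
theorem abs_bumpSum_le {B γ : ℝ} (hγ : 0 ≤ γ) (hc : ∀ k, |c k| ≤ γ) {L : ℕ}
    (hB : ∀ a ≤ L, ∀ t : ℝ, ∑ l : Fin m, |iteratedDeriv a φ (t - l)| ≤ B)
    {α : Fin r → ℕ} (hα : ∑ j, α j ≤ L) (x : Fin r → ℝ) :
    |bumpSum φ c α x| ≤ γ * (m : ℝ) ^ (∑ j, α j) * B ^ r := by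
  have hαj : ∀ j, α j ≤ L := fun j =>
    (Finset.single_le_sum (fun _ _ => Nat.zero_le _) (Finset.mem_univ j)).trans hα
  calc |bumpSum φ c α x| ≤ ∑ k : Fin r → Fin m, γ * ∏ j, ((m : ℝ) ^ α j *
        |iteratedDeriv (α j) φ ((m / 2 : ℝ) * (x j + 1) - 1 / 2 - (k j : ℕ))|) := by
        refine (Finset.abs_sum_le_sum_abs _ _).trans (Finset.sum_le_sum fun k _ => ?_)
        rw [abs_mul, Finset.abs_prod]
        gcongr with j
        · exact hc k
        · rw [abs_mul, abs_of_nonneg (by positivity)]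
          gcongr
          exact half_le_self (Nat.cast_nonneg m)
    _ = γ * ∏ j, ∑ l : Fin m, ((m : ℝ) ^ α j *
        |iteratedDeriv (α j) φ ((m / 2 : ℝ) * (x j + 1) - 1 / 2 - (l : ℕ))|) := by
        rw [Finset.prod_univ_sum, Fintype.piFinset_univ, Finset.mul_sum]
    _ ≤ γ * ∏ j : Fin r, ((m : ℝ) ^ α j * B) := by
        gcongr with j
        rw [← Finset.mul_sum]
        gcongr
        exact hB _ (hαj j) _
    _ = _ := by
        rw [Finset.prod_mul_distrib, Finset.prod_pow_eq_pow_sum]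
        simp [mul_assoc]

/-- Mean value inequality. For the sup norm, the operator norm of the derivative is at most the sum
of the `r` absolute partial derivatives, whence the factor `r`. -/
theorem abs_bumpSum_sub_le {B γ : ℝ} (hφ : ContDiff ℝ (⊤ : ℕ∞) φ)
    (hγ : 0 ≤ γ) (hc : ∀ k, |c k| ≤ γ) {L : ℕ}
    (hB : ∀ a ≤ L, ∀ t : ℝ, ∑ l : Fin m, |iteratedDeriv a φ (t - l)| ≤ B)
    {α : Fin r → ℕ} (hα : ∑ j, α j + 1 ≤ L) (x y : Fin r → ℝ) :
    |bumpSum φ c α x - bumpSum φ c α y| ≤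
      r * (γ * (m : ℝ) ^ (∑ j, α j + 1) * B ^ r) * ‖x - y‖ := by
  have hB0 : 0 ≤ B := (Finset.sum_nonneg fun l _ => abs_nonneg _).trans (hB 0 (Nat.zero_le _) 0)
  refine Convex.norm_image_sub_le_of_norm_fderiv_le (𝕜 := ℝ) (s := Set.univ)
    (fun z _ => (contDiff_bumpSum hφ α).differentiable (by simp) z) (fun z _ => ?_) convex_univ
    (Set.mem_univ y) (Set.mem_univ x)
  refine ContinuousLinearMap.opNorm_le_bound _ (by positivity) fun v => ?_
  have hv : v = ∑ i, v i • Pi.single i (1 : ℝ) := by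
    ext j; simp [Finset.sum_apply, Pi.single_apply]
  conv_lhs => rw [hv]
  rw [map_sum]
  calc _ ≤ ∑ i : Fin r, ‖v‖ * (γ * (m : ℝ) ^ (∑ j, α j + 1) * B ^ r) := by
        refine (norm_sum_le _ _).trans (Finset.sum_le_sum fun i _ => ?_)
        rw [map_smul, norm_smul, fderiv_bumpSum_single hφ]
        have hsum := sum_update_add_one α i
        gcongr
        · exact norm_le_pi_norm v i
        · have := abs_bumpSum_le hγ hc hB (α := Function.update α i (α i + 1)) (hsum ▸ hα) z
          rwa [hsum] at this
    _ = _ := by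
        rw [Finset.sum_const, Finset.card_univ, Fintype.card_fin, nsmul_eq_mul]; ring

end bumpSum

theorem uniqueDiffOn_cube (r : ℕ) : UniqueDiffOn ℝ (cube r) := by
  have : cube r = Set.univ.pi fun _ => Set.Icc (-1 : ℝ) 1 := by
    rw [Set.pi_univ_Icc]; rfl
  rw [this]
  exact UniqueDiffOn.univ_pi fun _ => uniqueDiffOn_Icc (by norm_num)

theorem strictFloor_lt {β : ℝ} (hβ : 0 < β) : (strictFloor β : ℝ) < β := by
  have h1 := Nat.ceil_lt_add_one hβ.le
  have h2 : 1 ≤ ⌈β⌉₊ := Nat.one_le_ceil_iff.2 hβ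
  rw [strictFloor, Nat.cast_sub h2]
  push_cast
  linarith

theorem le_strictFloor_add_one {β : ℝ} (hβ : 0 < β) : β ≤ strictFloor β + 1 := by
  have h2 : 1 ≤ ⌈β⌉₊ := Nat.one_le_ceil_iff.2 hβ
  rw [strictFloor, Nat.cast_sub h2]
  push_cast
  linarith [Nat.le_ceil β]

theorem two_mul_le_two_pow {r : ℕ} (hr : 1 ≤ r) : (2 * r : ℝ) ≤ 2 ^ r := by
  obtain ⟨k, rfl⟩ : ∃ k, r = k + 1 := ⟨r - 1, by omega⟩
  have := @Nat.lt_two_pow_self k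
  rw [pow_succ, mul_comm]
  gcongr
  exact_mod_cast this

section bumpSum

variable {φ : ℝ → ℝ} {r m : ℕ} {c : (Fin r → Fin m) → ℝ}

theorem cubePartial_bumpSum (hφ : ContDiff ℝ (⊤ : ℕ∞) φ) {n : ℕ} (i : Fin n → Fin r) :
    ∃ α : Fin r → ℕ, ∑ j, α j = n ∧ ∀ x ∈ cube r,
      cubePartial (bumpSum φ c 0) i x = bumpSum φ c α x := by
  obtain ⟨α, hα, h⟩ := iteratedFDeriv_bumpSum_single (c := c) hφ i
  refine ⟨α, hα, fun x hx => ?_⟩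
  rw [cubePartial, iteratedFDerivWithin_eq_iteratedFDeriv (uniqueDiffOn_cube r) _ hx, h]
  exact ((contDiff_bumpSum hφ 0).of_le (by exact_mod_cast le_top)).contDiffAt

/-- Partial derivatives of order `L = strictFloor β` are bounded by `M = γ m ^ L B ^ r` and
Lipschitz with constant `r m M`; the latter is why `hB` goes one order further. The Lipschitz bound
is used at distances `t ≤ 1 / m`, twice the sup bound beyond. Both are at most `2 r M (m t) ^ (β -
L)`, and `2 r ≤ 2 ^ r` explains the `2 ^ r` in `hD`. -/
theorem holderNorm_bumpSum_le {β : ℝ} (hβ : 0 < β) {B γ D : ℝ} (hφ : ContDiff ℝ (⊤ : ℕ∞) φ)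
    (hr : 1 ≤ r) (hm : 1 ≤ m) (hγ : 0 ≤ γ) (hc : ∀ k, |c k| ≤ γ)
    (hB : ∀ a ≤ strictFloor β + 1, ∀ t : ℝ, ∑ l : Fin m, |iteratedDeriv a φ (t - l)| ≤ B)
    (hD : γ * (m : ℝ) ^ β * (2 * B) ^ r ≤ D) :
    holderNorm β (bumpSum φ c 0) ≤ ENNReal.ofReal D := by
  have hB0 : 0 ≤ B := (Finset.sum_nonneg fun l _ => abs_nonneg _).trans (hB 0 (Nat.zero_le _) 0)
  have hm1 : (1 : ℝ) ≤ m := by exact_mod_cast hm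
  have hL := strictFloor_lt hβ
  have hL' := le_strictFloor_add_one hβ
  set L := strictFloor β
  rw [mul_pow] at hD
  have hr2 : (1 : ℝ) ≤ 2 ^ r := one_le_pow₀ one_le_two
  refine max_le ?_ ?_
  · refine iSup₂_le fun k hk => iSup_le fun i => iSup₂_le fun x hx => ENNReal.ofReal_le_ofReal ?_
    obtain ⟨α, hα, h⟩ := cubePartial_bumpSum (c := c) hφ i
    rw [h x hx]
    refine (abs_bumpSum_le hγ hc hB (by omega) x).trans (le_trans ?_ hD)
    rw [hα]
    have hmk : (m : ℝ) ^ k ≤ (m : ℝ) ^ β := by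
      rw [← Real.rpow_natCast]
      refine Real.rpow_le_rpow_of_exponent_le hm1 (le_trans ?_ hL.le)
      exact_mod_cast hk
    gcongr
    exact le_mul_of_one_le_left (by positivity) hr2
  · refine iSup_le fun i => iSup₂_le fun x hx => iSup₂_le fun y hy => iSup_le fun hxy =>
      ENNReal.ofReal_le_ofReal ?_
    obtain ⟨α, hα, h⟩ := cubePartial_bumpSum (c := c) hφ i
    rw [h x hx, h y hy]
    have ht : 0 < ‖x - y‖ := norm_pos_iff.2 (sub_ne_zero.2 hxy)
    set t := ‖x - y‖
    have hx' := abs_bumpSum_le hγ hc hB (α := α) (by omega) x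
    have hy' := abs_bumpSum_le hγ hc hB (α := α) (by omega) y
    have hxy' := abs_bumpSum_sub_le hφ hγ hc hB (α := α) (by omega) x y
    rw [hα] at hx' hy' hxy'
    rw [pow_succ] at hxy'
    have hA : 0 ≤ γ * (m : ℝ) ^ L * B ^ r := by positivity
    have hr1 : (1 : ℝ) ≤ r := by exact_mod_cast hr
    rw [div_le_iff₀ (by positivity)]
    have hmt : |bumpSum φ c α x - bumpSum φ c α y| ≤
        2 * r * (γ * (m : ℝ) ^ L * B ^ r) * (m * t) ^ (β - L) := by
      rcases le_total (m * t) 1 with h1 | h1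
      · have : m * t ≤ (m * t) ^ (β - L) := by
          conv_lhs => rw [← Real.rpow_one (m * t)]
          exact Real.rpow_le_rpow_of_exponent_ge (by positivity) h1 (by linarith)
        calc _ ≤ _ := hxy'
          _ = r * (γ * (m : ℝ) ^ L * B ^ r) * (m * t) := by ring
          _ ≤ r * (γ * (m : ℝ) ^ L * B ^ r) * (m * t) ^ (β - L) := by gcongr
          _ ≤ _ := by
            refine mul_le_mul_of_nonneg_right ?_ (by positivity)
            nlinarith [mul_nonneg (zero_le_one.trans hr1) hA]
      · have : 1 ≤ (m * t) ^ (β - L) := Real.one_le_rpow h1 (by linarith)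
        calc _ ≤ 2 * (γ * (m : ℝ) ^ L * B ^ r) := by
              have := abs_sub (bumpSum φ c α x) (bumpSum φ c α y)
              linarith
          _ ≤ 2 * r * (γ * (m : ℝ) ^ L * B ^ r) * 1 := by nlinarith
          _ ≤ _ := by gcongr
    refine hmt.trans ?_
    rw [Real.mul_rpow (by positivity) ht.le, ← mul_assoc]
    refine mul_le_mul_of_nonneg_right (le_trans ?_ hD) (by positivity)
    have hmm : (m : ℝ) ^ L * (m : ℝ) ^ (β - L) = (m : ℝ) ^ β := by
      rw [← Real.rpow_natCast, ← Real.rpow_add (by linarith)]; congr 1; ring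
    calc 2 * r * (γ * (m : ℝ) ^ L * B ^ r) * (m : ℝ) ^ (β - L)
        = 2 * r * (γ * ((m : ℝ) ^ L * (m : ℝ) ^ (β - L)) * B ^ r) := by ring
      _ ≤ 2 ^ r * (γ * (m : ℝ) ^ β * B ^ r) := by
          rw [hmm]; gcongr; exact two_mul_le_two_pow hr
      _ = _ := by ring

theorem bumpSum_comp_mem_classVS {β : ℝ} (hβ : 0 < β) {B γ D : ℝ} (hφ : ContDiff ℝ (⊤ : ℕ∞) φ)
    (hr : 1 ≤ r) (hm : 1 ≤ m) (hγ : 0 ≤ γ) (hc : ∀ k, |c k| ≤ γ)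
    (hB : ∀ a ≤ strictFloor β + 1, ∀ t : ℝ, ∑ l : Fin m, |iteratedDeriv a φ (t - l)| ≤ B)
    (hD : γ * (m : ℝ) ^ β * (2 * B) ^ r ≤ D) (h1 : γ * B ^ r ≤ 1)
    {d : ℕ} {e : Fin r → Fin d} (he : Function.Injective e) :
    (fun x : cube d => bumpSum φ c 0 fun j => x.1 (e j)) ∈ classVS D β d r := by
  refine ⟨e, bumpSum φ c 0, he, fun _ => rfl,
    ((contDiff_bumpSum hφ 0).of_le (by exact_mod_cast le_top)).contDiffOn, fun x _ => ?_,
    holderNorm_bumpSum_le hβ hφ hr hm hγ hc hB hD⟩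
  have := abs_bumpSum_le hγ hc hB (α := 0) (by simp) x
  simpa using this.trans (by simpa using h1)

end bumpSum

/-! ### Grid cells and the nonasymptotic bound. -/

/-- The rescaling is that of `bumpSum`, so a point of cell `k` lies where the bump with index `k`
equals `1`. -/
theorem exists_cell_map {m : ℕ} (hm : 1 ≤ m) : ∃ cell : ℝ → Fin m, Measurable cell ∧
    ∀ t ∈ Set.Icc (-1 : ℝ) 1, |(m / 2 : ℝ) * (t + 1) - 1 / 2 - (cell t : ℕ)| ≤ 1 / 2 := by
  -- The truncation puts the endpoint `t = 1` into the last cell.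
  let g : ℕ → Fin m := fun l => ⟨min l (m - 1), by omega⟩
  refine ⟨fun t => g ⌊(m / 2 : ℝ) * (t + 1)⌋₊, ?_, fun t ht => ?_⟩
  · exact (measurable_from_nat (f := g)).comp (Nat.measurable_floor.comp (by fun_prop))
  · obtain ⟨h1, h2⟩ := ht
    have hmR : (1 : ℝ) ≤ m := by exact_mod_cast hm
    set u := (m / 2 : ℝ) * (t + 1) with hu
    have hu0 : 0 ≤ u := mul_nonneg (by positivity) (by linarith)
    have hum : u ≤ m := by nlinarith
    have hf1 := Nat.floor_le hu0
    have hf2 := Nat.lt_floor_add_one u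
    rcases le_total ⌊u⌋₊ (m - 1) with h | h
    · have hg : (g ⌊u⌋₊ : ℕ) = ⌊u⌋₊ := min_eq_left h
      rw [hg]
      rw [abs_le]; constructor <;> linarith
    · have h' : (m : ℝ) - 1 ≤ ⌊u⌋₊ := by
        rw [← Nat.cast_one, ← Nat.cast_sub hm]; exact_mod_cast h
      have hg : (g ⌊u⌋₊ : ℕ) = m - 1 := min_eq_right h
      rw [hg, Nat.cast_sub hm, Nat.cast_one, abs_le]; constructor <;> linarith

/-- A cell lies in a box of side `2 / m`, on which the density is at most `Cg ^ d`. -/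
theorem IsDesign.measureReal_cell_le {d m : ℕ} {cg Cg A : ℝ} {μ : Measure (cube d)}
    (hμ : IsDesign cg Cg μ) (hC : 0 < Cg) (hA : 2 * Cg ≤ A) (hm : 1 ≤ m) {cell : ℝ → Fin m}
    (hcell : ∀ t ∈ Set.Icc (-1 : ℝ) 1, |(m / 2 : ℝ) * (t + 1) - 1 / 2 - (cell t : ℕ)| ≤ 1 / 2)
    (κ : Fin d → Fin m) :
    μ.real {x | (fun j => cell (x.1 j)) = κ} ≤ (A / m) ^ d := by
  obtain ⟨-, p, hp, hpC, rfl⟩ := hμ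
  have hmR : (0 : ℝ) < m := by exact_mod_cast hm
  have hcube : MeasurableSet (cube d) := measurableSet_Icc
  let box : Set (Fin d → ℝ) :=
    Set.Icc (fun j => 2 * (κ j : ℕ) / m - 1) fun j => 2 * (κ j : ℕ) / m - 1 + 2 / m
  have hbox : MeasurableSet box := measurableSet_Icc
  have hsub : {x : cube d | (fun j => cell (x.1 j)) = κ} ⊆ Subtype.val ⁻¹' box := by
    intro x hx
    have key : ∀ j, 2 * ((κ j : ℕ) : ℝ) / m - 1 ≤ x.1 j ∧
        x.1 j ≤ 2 * ((κ j : ℕ) : ℝ) / m - 1 + 2 / m := fun j => by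
      have h := hcell (x.1 j) ⟨x.2.1 j, x.2.2 j⟩
      rw [show cell (x.1 j) = κ j from congrFun hx j, abs_le] at h
      constructor
      · rw [sub_le_iff_le_add, div_le_iff₀ hmR]; linarith [h.1]
      · have : x.1 j + 1 ≤ (2 * (κ j : ℕ) + 2) / m := by
          rw [le_div_iff₀ hmR]; linarith [h.2]
        rw [add_div] at this
        linarith
    exact ⟨fun j => (key j).1, fun j => (key j).2⟩
  have hA0 : 0 ≤ A := (by positivity : 0 ≤ 2 * Cg).trans hA
  refine ENNReal.toReal_le_of_le_ofReal (by positivity) ?_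
  calc _ ≤ _ := measure_mono hsub
    _ = ∫⁻ x in Subtype.val ⁻¹' box, ENNReal.ofReal (p x) ∂(Measure.comap Subtype.val volume) :=
        withDensity_apply _ (measurable_subtype_coe hbox)
    _ ≤ ∫⁻ _ in Subtype.val ⁻¹' box, ENNReal.ofReal (Cg ^ d) ∂(Measure.comap Subtype.val volume) :=
        lintegral_mono fun x => ENNReal.ofReal_le_ofReal (hpC x).2
    _ = ENNReal.ofReal (Cg ^ d) * Measure.comap Subtype.val volume (Subtype.val ⁻¹' box : Set (cube d)) :=
        setLIntegral_const _ _
    _ ≤ ENNReal.ofReal (Cg ^ d) * volume box := by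
        gcongr
        rw [(MeasurableEmbedding.subtype_coe hcube).comap_apply]
        exact measure_mono (Set.image_preimage_subset _ _)
    _ = ENNReal.ofReal ((2 * Cg / m) ^ d) := by
        rw [Real.volume_Icc_pi]
        simp only [add_sub_cancel_left]
        rw [Finset.prod_const, Finset.card_univ, Fintype.card_fin,
          ← ENNReal.ofReal_pow (by positivity), ← ENNReal.ofReal_mul (by positivity), ← mul_pow]
        congr 2; ring
    _ ≤ _ := ENNReal.ofReal_le_ofReal (by gcongr)

/-- The nonasymptotic lower bound, with `m` cells per coordinate and amplitude `γ`. -/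
theorem minimaxL2Risk_classVS_ge {β D B γ cg Cg A : ℝ} (hβ : 0 < β) {φ : ℝ → ℝ}
    (hφ : ContDiff ℝ (⊤ : ℕ∞) φ) (hφ1 : ∀ t, |t| ≤ 1 / 2 → φ t = 1) (hB1 : 1 ≤ B)
    (hB : ∀ a ≤ strictFloor β + 1, ∀ (m : ℕ) (t : ℝ),
      ∑ l : Fin m, |iteratedDeriv a φ (t - l)| ≤ B)
    (hB2 : ∀ (m : ℕ) (t : ℝ), ∑ l : Fin m, φ (t - l) ^ 2 ≤ B)
    {n d r m : ℕ} (hn : 1 ≤ n) (hr : 1 ≤ r) (hrd : r ≤ d) (hm : 1 ≤ m) (hγ : 0 ≤ γ)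
    (hD : γ * (m : ℝ) ^ β * (2 * B) ^ r ≤ D) (h1 : γ * B ^ r ≤ 1)
    (hnγ : n * γ ^ 2 ≤ (m : ℝ) ^ r)
    (hC : 0 < Cg) (hA1 : 1 ≤ A) (hA : 2 * Cg ≤ A) {μ : Measure (cube d)}
    (hμ : IsDesign cg Cg μ) :
    ENNReal.ofReal (γ ^ 2 / 16 * (A ^ (2 * r) * (1 + B ^ r))⁻¹) ≤
      minimaxL2Risk n μ (classVS D β d r) := by
  have : IsProbabilityMeasure μ := hμ.1
  obtain ⟨cell, hcm, hcell⟩ := exists_cell_map hm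
  have hmR : (0 : ℝ) < m := by exact_mod_cast hm
  let ψ : (Fin r → Fin d) → (Fin r → Fin m) → cube d → ℝ := fun e k x =>
    ∏ j, φ ((m / 2 : ℝ) * (x.1 (e j) + 1) - 1 / 2 - (k j : ℕ))
  have hψm : ∀ e k, Measurable (ψ e k) := fun e k => by
    refine Finset.measurable_fun_prod _ fun j _ => hφ.continuous.measurable.comp ?_
    have : Measurable fun x : cube d => x.1 (e j) :=
      (measurable_pi_apply _).comp measurable_subtype_coe
    exact (((this.add_const 1).const_mul _).sub_const _).sub_const _
  have hψsum : ∀ e x, ∑ k, ψ e k x ^ 2 ≤ B ^ r := fun e x => by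
    calc ∑ k, ψ e k x ^ 2
        = ∏ j, ∑ l : Fin m, φ ((m / 2 : ℝ) * (x.1 (e j) + 1) - 1 / 2 - (l : ℕ)) ^ 2 := by
          rw [Finset.prod_univ_sum, Fintype.piFinset_univ]
          exact Finset.sum_congr rfl fun k _ => (Finset.prod_pow _ _ _).symm
      _ ≤ ∏ _j : Fin r, B := Finset.prod_le_prod
          (fun j _ => Finset.sum_nonneg fun l _ => sq_nonneg _) fun j _ => hB2 m _
      _ = B ^ r := by simp
  have hint : ∀ e k, Integrable (fun x => ψ e k x ^ 2) μ := fun e k =>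
    Integrable.of_bound ((hψm e k).pow_const 2).aestronglyMeasurable (B ^ r)
      (Filter.Eventually.of_forall fun x => by
        rw [Real.norm_of_nonneg (sq_nonneg _)]
        exact (Finset.single_le_sum (f := fun k => ψ e k x ^ 2) (fun k _ => sq_nonneg _)
          (Finset.mem_univ k)).trans (hψsum e x))
  let s : (Fin r → Fin d) → (Fin r → Fin m) → ℝ := fun e k => ∫ x, ψ e k x ^ 2 ∂μ
  have hs0 : ∀ e k, 0 ≤ s e k := fun e k => integral_nonneg fun x => sq_nonneg _
  have hssum : ∀ e, ∑ k, s e k ≤ B ^ r := fun e => by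
    simp only [s]
    rw [← integral_finsetSum _ fun k _ => hint e k]
    calc _ ≤ ∫ _, B ^ r ∂μ := integral_mono (integrable_finsetSum _ fun k _ => hint e k)
          (integrable_const _) (hψsum e)
      _ = B ^ r := by simp
  let Q : (Fin d → Fin m) → Set (cube d) := fun κ => {x | (fun j => cell (x.1 j)) = κ}
  have hvec : Measurable fun (x : cube d) j => cell (x.1 j) := measurable_pi_lambda _ fun j =>
    hcm.comp ((measurable_pi_apply j).comp measurable_subtype_coe)
  have hsumQ : ∀ t : Finset (Fin d → Fin m),
      ∑ κ ∈ t, μ.real (Q κ) = μ.real ((fun (x : cube d) j => cell (x.1 j)) ⁻¹' t) := fun t =>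
    sum_measureReal_preimage_singleton t fun κ _ => hvec (measurableSet_singleton κ)
  have hq : 0 < d / r := Nat.div_pos hrd hr
  obtain ⟨e, he, hblock⟩ := exists_block (P := fun κ => μ.real (Q κ)) (q := d / r) (s := r) (d := d)
    hq hm (Nat.div_mul_le_self d r)
    (by
      have := Nat.div_add_mod d r
      have h2 := Nat.mod_lt d hr
      have h3 : r ≤ d / r * r := Nat.le_mul_of_pos_left r hq
      rw [mul_comm r] at this
      rw [mul_assoc, two_mul]
      omega)
    hA1 (show 0 < 1 + B ^ r by positivity) (fun κ => measureReal_nonneg)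
    (by rw [hsumQ]; simp) (hμ.measureReal_cell_le hC hA hm hcell)
    (fun e k => 1 + (m : ℝ) ^ r * s e k)
    (fun e k => by have := hs0 e k; positivity)
    -- The squared bumps sum to at most `B ^ r` pointwise, so the `s e k` do too, and the weights
    -- average at most `W = 1 + B ^ r` over the `m ^ r` cells.
    (fun e _ => by
      rw [Finset.sum_add_distrib, ← Finset.mul_sum]
      simp only [Finset.sum_const, Finset.card_univ, Fintype.card_fun, Fintype.card_fin, nsmul_eq_mul,
        mul_one, Nat.cast_pow]
      have := mul_le_mul_of_nonneg_left (hssum e) (pow_pos hmR r).le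
      linarith)
  let P : (Fin r → Fin m) → Set (cube d) := fun k => {x | (fun j => cell (x.1 (e j))) = k}
  have hP : ∀ k, μ.real (P k) = ∑ κ with κ ∘ e = k, μ.real (Q κ) := fun k => by
    rw [hsumQ]
    congr 1
    ext x
    simp [P, Function.comp_def]
  have hPm : ∀ k, MeasurableSet (P k) := fun k => by
    have : Measurable fun (x : cube d) j => cell (x.1 (e j)) := measurable_pi_lambda _ fun j =>
      hcm.comp ((measurable_pi_apply (e j)).comp measurable_subtype_coe)
    exact this (measurableSet_singleton k)
  have hden : ∀ k, 0 < 1 + n * γ ^ 2 * s e k := fun k => by have := hs0 e k; positivity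
  -- Behaves like `min γ (1 / √(n * s e k))`: the largest amplitude, up to constants, that is both
  -- smooth enough and undetectable.
  let a : (Fin r → Fin m) → ℝ := fun k => γ / √(1 + n * γ ^ 2 * s e k)
  have ha : ∀ k, a k ^ 2 = γ ^ 2 / (1 + n * γ ^ 2 * s e k) := fun k => by
    rw [div_pow, Real.sq_sqrt (hden k).le]
  have ha0 : ∀ k, 0 ≤ a k := fun k => by positivity
  have haγ : ∀ k, a k ≤ γ := fun k => by
    refine div_le_self hγ (Real.one_le_sqrt.2 ?_)
    have := hs0 e k
    have : 0 ≤ n * γ ^ 2 * s e k := by positivity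
    linarith
  refine le_trans (ENNReal.ofReal_le_ofReal ?_) (assouad_minimaxL2Risk hn μ (classVS D β d r)
    (ψ e) (hψm e) P hPm ?_ a ?_ ?_ (hint e) ?_)
  · calc γ ^ 2 / 16 * (A ^ (2 * r) * (1 + B ^ r))⁻¹
        ≤ γ ^ 2 / 16 * ∑ κ, μ.real (Q κ) / (1 + (m : ℝ) ^ r * s e (κ ∘ e)) := by gcongr
      _ = γ ^ 2 / 16 * ∑ k, μ.real (P k) / (1 + (m : ℝ) ^ r * s e k) := by
          congr 1
          rw [← Finset.sum_fiberwise Finset.univ (fun κ : Fin d → Fin m => κ ∘ e)]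
          refine Finset.sum_congr rfl fun k _ => ?_
          rw [hP, Finset.sum_div]
          refine Finset.sum_congr rfl fun κ hκ => ?_
          rw [(Finset.mem_filter.1 hκ).2]
      _ ≤ ∑ k, a k ^ 2 * μ.real (P k) / 16 := by
          rw [Finset.mul_sum]
          refine Finset.sum_le_sum fun k _ => ?_
          -- `hnγ` replaces `n * γ ^ 2` by `m ^ r`, giving the weights for which the block `e` was
          -- selected.
          have h3 : 1 + n * γ ^ 2 * s e k ≤ 1 + (m : ℝ) ^ r * s e k := by
            have := hs0 e k
            gcongr
          calc _ = γ ^ 2 * μ.real (P k) / 16 / (1 + (m : ℝ) ^ r * s e k) := by ring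
            _ ≤ γ ^ 2 * μ.real (P k) / 16 / (1 + n * γ ^ 2 * s e k) :=
                div_le_div_of_nonneg_left (by positivity) (hden k) h3
            _ = _ := by rw [ha]; ring
  · intro k l hkl
    rw [Set.disjoint_left]
    intro x hx hx'
    exact hkl ((show _ = k from hx).symm.trans hx')
  · intro k x hx
    refine Finset.prod_eq_one fun j _ => hφ1 _ ?_
    rw [← show cell (x.1 (e j)) = k j from congrFun hx j]
    exact hcell _ ⟨x.2.1 _, x.2.2 _⟩
  · intro ω
    have := bumpSum_comp_mem_classVS (c := fun k => if ω k then a k else 0) hβ hφ hr hm hγ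
      (fun k => by
        split_ifs
        · rw [abs_of_nonneg (ha0 k)]; exact haγ k
        · simpa using hγ)
      (fun b hb => hB b hb m) hD h1 he
    simpa [bumpSum, ψ] using this
  · intro k
    rw [ha, div_mul_eq_mul_div, ← mul_div_assoc, div_le_one (hden k)]
    change n * (γ ^ 2 * s e k) ≤ _
    linarith

/-! ### Choice of parameters and conclusion. -/

theorem one_lt_log_of_three_le {n : ℕ} (hn : 3 ≤ n) : 1 < Real.log n := by
  have h3 : (3 : ℝ) ≤ n := by exact_mod_cast hn
  rw [Real.lt_log_iff_exp_lt (by linarith)]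
  linarith [Real.exp_one_lt_d9]

/-- Numbers `x ^ r` with `r ≤ (log n) ^ (1 / 2 - ε)` are of smaller order than any power of `n`. -/
theorem pow_le_rpow_of_le_log_rpow {x δ ε : ℝ} (hx : 0 < x) (hδ : 0 < δ) (hε : 0 < ε) {n r : ℕ}
    (hn3 : 3 ≤ n) (hn : ⌈Real.exp ((Real.log x / δ) ^ 2)⌉₊ ≤ n)
    (hr : (r : ℝ) ≤ Real.log n ^ (1 / 2 - ε)) : x ^ r ≤ (n : ℝ) ^ δ := by
  have hn0 : (0 : ℝ) < n := by positivity
  have hl := one_lt_log_of_three_le hn3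
  have hr' : (r : ℝ) ≤ √(Real.log n) := by
    rw [Real.sqrt_eq_rpow]
    exact hr.trans (Real.rpow_le_rpow_of_exponent_le hl.le (by linarith))
  -- The threshold on `n` is exactly this inequality; with `r ≤ √(log n)` it yields `r * |log x| ≤ δ
  -- * log n`.
  have hx' : |Real.log x| ≤ δ * √(Real.log n) := by
    have : (Real.log x / δ) ^ 2 ≤ Real.log n := by
      rw [Real.le_log_iff_exp_le hn0]
      exact (Nat.le_ceil _).trans (by exact_mod_cast hn)
    have := Real.abs_le_sqrt this
    rwa [abs_div, abs_of_pos hδ, div_le_iff₀ hδ, mul_comm] at this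
  rw [← Real.log_le_log_iff (by positivity) (by positivity), Real.log_pow, Real.log_rpow hn0]
  calc r * Real.log x ≤ r * |Real.log x| := by gcongr; exact le_abs_self _
    _ ≤ √(Real.log n) * (δ * √(Real.log n)) := by gcongr
    _ = δ * (√(Real.log n) * √(Real.log n)) := by ring
    _ = δ * Real.log n := by rw [Real.mul_self_sqrt (by linarith)]

/-- The choice of the number `m` of cells per coordinate. -/
theorem exists_resolution {β D : ℝ} (hβ : 0 < β) (hD : 0 < D) {n r : ℕ} (hn : 1 ≤ n)
    (hnD : 1 ≤ n * D ^ 2) (hDr : D ^ r ≤ (n : ℝ) ^ β) :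
    ∃ m : ℕ, 1 ≤ m ∧ D ≤ (m : ℝ) ^ β ∧ n * D ^ 2 ≤ ((m : ℝ) ^ β) ^ 2 * (m : ℝ) ^ r ∧
      (2 : ℝ) ^ (-(2 * β)) * (D ^ (2 * r / (2 * β + r)) * (n : ℝ) ^ (-(2 * β) / (2 * β + r))) ≤
        D ^ 2 * ((m : ℝ) ^ (-β)) ^ 2 := by
  have hs : 0 < 2 * β + r := by positivity
  have hn0 : (0 : ℝ) < n := by exact_mod_cast hn
  have hnD0 : 0 < n * D ^ 2 := by positivity
  -- Balances `n * (D * u ^ (-β)) ^ 2 = u ^ r`; rounding up to `m ≤ 2 * u` costs the factor `2 ^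
  -- (-(2 * β))`.
  set u : ℝ := (n * D ^ 2) ^ (1 / (2 * β + r)) with hu
  have hu1 : 1 ≤ u := Real.one_le_rpow hnD (by positivity)
  have hmu : u ≤ ⌈u⌉₊ := Nat.le_ceil u
  have hm2 : (⌈u⌉₊ : ℝ) ≤ 2 * u := by
    have := Nat.ceil_lt_add_one (zero_le_one.trans hu1)
    linarith
  have hm0 : (0 : ℝ) < ⌈u⌉₊ := by linarith
  have hpow : n * D ^ 2 ≤ (((⌈u⌉₊ : ℕ) : ℝ) ^ β) ^ 2 * ((⌈u⌉₊ : ℕ) : ℝ) ^ r := by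
    calc n * D ^ 2 = u ^ (2 * β + r) := by
          rw [hu, ← Real.rpow_mul hnD0.le, one_div, inv_mul_cancel₀ hs.ne', Real.rpow_one]
      _ ≤ (⌈u⌉₊ : ℝ) ^ (2 * β + r) := by gcongr
      _ = _ := by
          rw [Real.rpow_add hm0, Real.rpow_natCast, ← Real.rpow_mul_natCast hm0.le]
          congr 2; push_cast; ring
  refine ⟨⌈u⌉₊, Nat.one_le_ceil_iff.2 (by linarith), ?_, hpow, ?_⟩
  -- If `m ^ β < D`, then `m ^ (r β) ≤ D ^ r ≤ n ^ β`, so `m ^ r ≤ n` and `m ^ (2β) * m ^ r < n * D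
  -- ^ 2`, against `hpow`.
  · by_contra! hlt
    have h2 : (((⌈u⌉₊ : ℕ) : ℝ) ^ r) ≤ n := by
      have h3 : (((⌈u⌉₊ : ℕ) : ℝ) ^ r) ^ β ≤ (n : ℝ) ^ β := by
        rw [← Real.rpow_natCast, ← Real.rpow_mul hm0.le, mul_comm, Real.rpow_mul hm0.le,
          Real.rpow_natCast]
        exact (pow_le_pow_left₀ (by positivity) hlt.le r).trans hDr
      exact (Real.rpow_le_rpow_iff (by positivity) hn0.le hβ).1 h3
    have h4 : (((⌈u⌉₊ : ℕ) : ℝ) ^ β) ^ 2 < D ^ 2 := by gcongr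
    have h5 : 0 < (((⌈u⌉₊ : ℕ) : ℝ) ^ r) := by positivity
    nlinarith [mul_lt_mul_of_pos_right h4 h5, mul_le_mul_of_nonneg_left h2 (sq_nonneg D)]
  · have h1 : (2 * u) ^ (-(2 * β)) ≤ (((⌈u⌉₊ : ℕ) : ℝ) ^ (-β)) ^ 2 := by
      rw [← Real.rpow_mul_natCast hm0.le]
      have : -β * ((2 : ℕ) : ℝ) = -(2 * β) := by push_cast; ring
      rw [this]
      exact Real.rpow_le_rpow_of_nonpos hm0 hm2 (by linarith)
    refine le_trans (le_of_eq ?_) (mul_le_mul_of_nonneg_left h1 (sq_nonneg D))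
    rw [Real.mul_rpow two_pos.le (by linarith), hu, ← Real.rpow_mul hnD0.le,
      Real.mul_rpow hn0.le (sq_nonneg D), ← Real.rpow_natCast D 2, ← Real.rpow_mul hD.le]
    have e1 : 1 / (2 * β + r) * -(2 * β) = -(2 * β) / (2 * β + r) := by ring
    have e2 : 2 * (r : ℝ) / (2 * β + r) =
        ((2 : ℕ) : ℝ) + ((2 : ℕ) : ℝ) * (-(2 * β) / (2 * β + r)) := by
      field_simp; push_cast; ring
    rw [e1, e2, Real.rpow_add hD]
    ring

theorem mainTheorem11 (β : ℝ) (hβ : 0 < β) :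
    ∃ N₀ : ℝ → ℕ, ∀ cg Cg : ℝ, 0 < cg → 0 < Cg →
      ∃ C₂ c₂ : ℝ, 0 < C₂ ∧ 0 < c₂ ∧
        (∀ D : ℝ, 0 < D → ∃ κ : ℝ, 0 < κ ∧
          ∀ ε : ℝ, 0 < ε → ε < 1 / 2 →
          ∀ n d ds : ℕ, N₀ D ≤ n → 1 ≤ ds → ds ≤ d → (ds : ℝ) ≤ Real.log n ^ (1 / 2 - ε) →
          ∀ μ : Measure (cube d), IsDesign cg Cg μ →
            ENNReal.ofReal (C₂ * c₂ ^ ds * D ^ (2 * ds / (2 * β + ds)) *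
                (n : ℝ) ^ (-(2 * β) / (2 * β + ds))) ≤
              minimaxL2Risk n μ (classVS D β d ds) ∧
            ENNReal.ofReal (κ * c₂ ^ ds * (n : ℝ) ^ (-(2 * β) / (2 * β + ds))) ≤
              minimaxL2Risk n μ (classVS D β d ds)) ∧
        (∀ ε : ℝ, 0 < ε → ε < 1 / 2 → ∀ δ : ℝ, 0 < δ →
          ∃ N : ℕ, ∀ n ds : ℕ, N ≤ n → 1 ≤ ds → (ds : ℝ) ≤ Real.log n ^ (1 / 2 - ε) →
            (n : ℝ) ^ (-δ) ≤ c₂ ^ ds ∧ c₂ ^ ds ≤ (n : ℝ) ^ δ) := by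
  obtain ⟨φ, B, hB1, hφ, hφ1, hB, hB2⟩ := exists_plateau (strictFloor β + 1)
  -- The three thresholds ensure `log n > 1`, `n * D ^ 2 ≥ 1` and `D ^ ds ≤ n ^ β`.
  refine ⟨fun D => max 3 (max ⌈1 / D ^ 2⌉₊ ⌈Real.exp ((Real.log D / β) ^ 2)⌉₊),
    fun cg Cg _ hC => ?_⟩
  set A := max 1 (2 * Cg)
  have hA1 : 1 ≤ A := le_max_left _ _
  have hc0 : 0 < 8 * A ^ 2 * B ^ 3 := by positivity
  have hC₂ : 0 < (2 : ℝ) ^ (-(2 * β)) / 16 := by positivity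
  -- `8 A² B³ = (2B)² * (A² * 2B)`: the first factor comes from `γ²`, the second from the block
  -- selection, where `1 + B ^ ds ≤ (2B) ^ ds`.
  refine ⟨(2 : ℝ) ^ (-(2 * β)) / 16, (8 * A ^ 2 * B ^ 3)⁻¹, hC₂, inv_pos.2 hc0,
    fun D hD => ⟨(2 : ℝ) ^ (-(2 * β)) / 16 * min 1 (D ^ 2), by positivity, ?_⟩, ?_⟩
  · intro ε hε _ n d ds hN hds hdsd hlog μ hμ
    obtain ⟨hn3, hnD, hnexp⟩ : 3 ≤ n ∧ ⌈1 / D ^ 2⌉₊ ≤ n ∧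
        ⌈Real.exp ((Real.log D / β) ^ 2)⌉₊ ≤ n := by simpa only [max_le_iff] using hN
    have hmain : ENNReal.ofReal ((2 : ℝ) ^ (-(2 * β)) / 16 * (8 * A ^ 2 * B ^ 3)⁻¹ ^ ds *
        D ^ (2 * ds / (2 * β + ds)) * (n : ℝ) ^ (-(2 * β) / (2 * β + ds))) ≤
          minimaxL2Risk n μ (classVS D β d ds) := by
      obtain ⟨m, hm, hmD, hmn, hm2⟩ := exists_resolution (r := ds) hβ hD (by omega : 1 ≤ n)
        (by
          have : 1 / D ^ 2 ≤ n := (Nat.le_ceil _).trans (by exact_mod_cast hnD)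
          rwa [div_le_iff₀ (by positivity)] at this)
        (pow_le_rpow_of_le_log_rpow hD hβ hε hn3 hnexp hlog)
      have hm0 : (0 : ℝ) < m := by exact_mod_cast hm
      have hmβ : (m : ℝ) ^ (-β) * (m : ℝ) ^ β = 1 := by
        rw [← Real.rpow_add hm0]; simp
      have hmβ' : 0 < (m : ℝ) ^ (-β) := by positivity
      have hB2pos : 0 < (2 * B) ^ ds := by positivity
      have hDm : D * (m : ℝ) ^ (-β) ≤ 1 := by
        rw [← hmβ, mul_comm]; gcongr
      refine le_trans (ENNReal.ofReal_le_ofReal ?_) (minimaxL2Risk_classVS_ge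
        (γ := D * (m : ℝ) ^ (-β) / (2 * B) ^ ds) hβ hφ hφ1 hB1 hB hB2 (by omega : 1 ≤ n)
        hds hdsd hm (by positivity) ?_ ?_ ?_ hC hA1 (le_max_right _ _) hμ)
      · have hden : A ^ (2 * ds) * (1 + B ^ ds) ≤ (A ^ 2 * (2 * B)) ^ ds := by
          rw [mul_pow, ← pow_mul, mul_pow]
          have h1 : 1 ≤ B ^ ds := one_le_pow₀ hB1
          have h2 : (2 : ℝ) ≤ 2 ^ ds := le_self_pow₀ one_le_two (by omega)
          gcongr
          nlinarith
        calc _ = (2 : ℝ) ^ (-(2 * β)) * (D ^ (2 * ds / (2 * β + ds)) *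
                (n : ℝ) ^ (-(2 * β) / (2 * β + ds))) * ((8 * A ^ 2 * B ^ 3)⁻¹ ^ ds / 16) := by ring
          _ ≤ D ^ 2 * ((m : ℝ) ^ (-β)) ^ 2 * ((8 * A ^ 2 * B ^ 3)⁻¹ ^ ds / 16) := by gcongr
          _ = (D * (m : ℝ) ^ (-β) / (2 * B) ^ ds) ^ 2 / 16 * ((A ^ 2 * (2 * B)) ^ ds)⁻¹ := by
              have : 8 * A ^ 2 * B ^ 3 = (2 * B) ^ 2 * (A ^ 2 * (2 * B)) := by ring
              rw [this, inv_pow, mul_pow _ (A ^ 2 * (2 * B)), pow_right_comm (2 * B) 2 ds, mul_inv]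
              ring
          _ ≤ _ := by gcongr
      · refine le_of_eq ?_
        field_simp
        exact hmβ
      · rw [div_mul_eq_mul_div, div_le_one hB2pos]
        calc D * (m : ℝ) ^ (-β) * B ^ ds ≤ 1 * (2 * B) ^ ds := by
              gcongr; linarith
          _ = _ := one_mul _
      · have h1 : 1 ≤ (2 * B) ^ ds := one_le_pow₀ (by linarith)
        have h2 : D * (m : ℝ) ^ (-β) / (2 * B) ^ ds ≤ D * (m : ℝ) ^ (-β) :=
          div_le_self (by positivity) h1
        calc n * (D * (m : ℝ) ^ (-β) / (2 * B) ^ ds) ^ 2 ≤ n * (D * (m : ℝ) ^ (-β)) ^ 2 := by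
              gcongr
          _ = n * D ^ 2 * ((m : ℝ) ^ (-β)) ^ 2 := by ring
          _ ≤ ((m : ℝ) ^ β) ^ 2 * (m : ℝ) ^ ds * ((m : ℝ) ^ (-β)) ^ 2 := by gcongr
          _ = ((m : ℝ) ^ (-β) * (m : ℝ) ^ β) ^ 2 * (m : ℝ) ^ ds := by ring
          _ = _ := by rw [hmβ]; ring
    refine ⟨hmain, le_trans (ENNReal.ofReal_le_ofReal ?_) hmain⟩
    -- The exponent lies between `0` and `2`, so the power of `D` is bounded below uniformly in
    -- `ds`.
    have hexp : min 1 (D ^ 2) ≤ D ^ (2 * ds / (2 * β + ds) : ℝ) := by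
      rcases le_total 1 D with h | h
      · exact (min_le_left _ _).trans (Real.one_le_rpow h (by positivity))
      · refine (min_le_right _ _).trans ?_
        rw [← Real.rpow_natCast]
        refine Real.rpow_le_rpow_of_exponent_ge hD h ?_
        rw [div_le_iff₀ (by positivity)]
        push_cast
        linarith
    calc _ = (2 : ℝ) ^ (-(2 * β)) / 16 * (8 * A ^ 2 * B ^ 3)⁻¹ ^ ds * min 1 (D ^ 2) *
          (n : ℝ) ^ (-(2 * β) / (2 * β + ds)) := by ring
      _ ≤ _ := by gcongr
  · intro ε hε _ δ hδ
    refine ⟨max 3 ⌈Real.exp ((Real.log (8 * A ^ 2 * B ^ 3) / δ) ^ 2)⌉₊, fun n ds hN _ hlog => ?_⟩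
    have hn3 : 3 ≤ n := (le_max_left _ _).trans hN
    have hn1 : (1 : ℝ) ≤ n := by exact_mod_cast (by omega : 1 ≤ n)
    have h := pow_le_rpow_of_le_log_rpow hc0 hδ hε hn3 ((le_max_right _ _).trans hN) hlog
    have hc1 : 1 ≤ 8 * A ^ 2 * B ^ 3 := by
      have h1 : 1 ≤ A ^ 2 := one_le_pow₀ hA1
      have h2 : 1 ≤ B ^ 3 := one_le_pow₀ hB1
      nlinarith
    rw [inv_pow]
    constructor
    · rw [Real.rpow_neg (by positivity)]
      gcongr
    · exact (inv_le_one_of_one_le₀ (one_le_pow₀ hc1)).trans (Real.one_le_rpow hn1 hδ.le)
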